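/- Strictly positive formulas are built by the grammar $A ::= p \mid \top \mid (A\land B) \mid \alpha A$, where $p$ ranges over a countably infinite set of propositional variables and the modalities $\alpha$ range over the ordinals $\alpha\le\omega$. The logic $\mathrm{RC}\omega$ derives sequents $A\vdash B$ (with $A,B$ strictly positive formulas) by the following axioms and rules: 1. $A\vdash A$; $A\vdash\top$; if $A\vdash B$ and $B\vdash C$ then $A\vdash C$; 2. $A\land B\vdash A$; $A\land B\vdash B$; if $A\vdash B$ and $A\vdash C$ then $A\vdash B\land C$; 3. if $A\vdash B$ then $\alpha A\vdash\alpha B$; $\alpha\alpha A\vdash\alpha A$; 4. $\alpha\beta A\vdash\beta A$ and $\beta\alpha A\vdash\beta A$ for $\alpha\ge\beta$; 5. $\alpha A\land\beta B\vdash\alpha(A\land\beta B)$ for $\alpha>\beta$; 6. $\alpha A\vdash\beta A$ for $\alpha>\beta$; 7. $\omega A\vdash A$. The length $|A|$ of a formula is the number of its symbols, where every variable, modality, connective, constant and parenthesis counts as one symbol. The computation model is the random access machine with registers $X_0,X_1,\dots$ holding integers (initially $0$), with the instructions $X_i\leftarrow k$, $X_i\leftarrow X_j+X_k$, $X_i\leftarrow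 X_j-X_k$, $X_i\leftarrow X_{X_j}$, $X_{X_i}\leftarrow X_j$, "go to instruction $m$ if $X_j>0$", "read the next input integer into $X_i$" (which gives $0$ when the input is exhausted) and "append $X_i$ to the output". Every executed instruction costs one unit of time, and the machine halts when it leaves its program. The sequent $A\vdash B$ is given as its string of symbols, one integer code for each symbol, where distinct symbols have distinct nonzero codes: $(\,,\ ),\ \land,\ \top,\ \vdash,\ \omega$ are coded by $1,\dots,6$, the modality $n<\omega$ by $7+n$, and the $i$-th variable ($i\ge 0$) by $-1-i$. **Corollary.** The logic $\mathrm{RC}\omega$ is decidable in time bounded by a polynomial of degree four in the length of the sequent: there are a random access machine program $P$ and a polynomial $q$ with natural number coefficients and of degree $4$ such that, for all strictly positive formulas $A$ and $B$, the program $P$ on input $A\vdash B$ halts after at most $q(|A|+|B|)$ steps with output $1$ if $A\vdash B$ is provable in $\mathrm{RC}\omega$, and with output $0$ otherwise. -/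

import Mathlib

/-! Strictly positive modal formulas, the reflection calculus `RCω`, and unit-cost random access
machines. -/

namespace RCOmega

/-- Modalities: the ordinals `α ≤ ω`, where `⊤` stands for `ω`. -/
abbrev Modality : Type := WithTop ℕ

/-- Strictly positive formulas `A ::= p | ⊤ | (A ∧ B) | α A` with `α ≤ ω`; the propositional
variables are indexed by natural numbers. -/
inductive Formula : Type
  | var (p : ℕ)
  | top
  | conj (A B : Formula)
  | dia (α : Modality) (A : Formula)

open Formula

/-- `Derivable A B`: the sequent `A ⊢ B` is provable in `RCω`. -/
inductive Derivable : Formula → Formula → Prop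
  | refl (A : Formula) : Derivable A A
  | top_right (A : Formula) : Derivable A top
  | syllogism {A B C : Formula} : Derivable A B → Derivable B C → Derivable A C
  | conj_left (A B : Formula) : Derivable (conj A B) A
  | conj_right (A B : Formula) : Derivable (conj A B) B
  | conj_intro {A B C : Formula} : Derivable A B → Derivable A C → Derivable A (conj B C)
  | dia_mono (α : Modality) {A B : Formula} : Derivable A B → Derivable (dia α A) (dia α B)
  | dia_dia (α : Modality) (A : Formula) : Derivable (dia α (dia α A)) (dia α A)
  | dia_outer {α β : Modality} (A : Formula) :
      β ≤ α → Derivable (dia α (dia β A)) (dia β A)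
  | dia_inner {α β : Modality} (A : Formula) :
      β ≤ α → Derivable (dia β (dia α A)) (dia β A)
  | dia_conj {α β : Modality} (A B : Formula) :
      β < α → Derivable (conj (dia α A) (dia β B)) (dia α (conj A (dia β B)))
  | monotonicity {α β : Modality} (A : Formula) :
      β < α → Derivable (dia α A) (dia β A)
  | persistence (A : Formula) : Derivable (dia ⊤ A) A

/-- The symbols from which sequents are written. -/
inductive Token : Type
  | lparen
  | rparen
  | wedge
  | verum
  | turnstile
  | modality (α : Modality)
  | letter (p : ℕ)

/-- A formula as a string of symbols, fully parenthesised as in the grammar. -/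
def Formula.tokens : Formula → List Token
  | var p => [Token.letter p]
  | top => [Token.verum]
  | conj A B => [Token.lparen] ++ A.tokens ++ [Token.wedge] ++ B.tokens ++ [Token.rparen]
  | dia α A => Token.modality α :: A.tokens

/-- The length `|A|` of a formula: the number of its symbols, every symbol having size one. -/
def Formula.length (A : Formula) : ℕ := A.tokens.length

/-- The sequent `A ⊢ B` as a string of symbols. -/
def sequentTokens (A B : Formula) : List Token :=
  A.tokens ++ [Token.turnstile] ++ B.tokens

/-- The integer code of a symbol; distinct symbols have distinct codes and no code is `0`. -/
def Token.code : Token → ℤ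
  | lparen => 1
  | rparen => 2
  | wedge => 3
  | verum => 4
  | turnstile => 5
  | modality none => 6
  | modality (some n) => 7 + (n : ℤ)
  | letter p => -1 - (p : ℤ)

/-- The sequent `A ⊢ B` as an input for a machine: one integer for each symbol. -/
def encodeSequent (A B : Formula) : List ℤ := (sequentTokens A B).map Token.code

end RCOmega

namespace RAM

/-- The instructions of a random access machine with registers `X₀, X₁, X₂, …`, each of which
holds an integer. -/
inductive Instr : Type
  /-- `X_i ← k` -/
  | const (i : ℕ) (k : ℤ)
  /-- `X_i ← X_j + X_k` -/
  | add (i j k : ℕ)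
  /-- `X_i ← X_j - X_k` -/
  | sub (i j k : ℕ)
  /-- `X_i ← X_{X_j}` -/
  | load (i j : ℕ)
  /-- `X_{X_i} ← X_j` -/
  | store (i j : ℕ)
  /-- go to instruction `m` if `X_j > 0` -/
  | jumpPos (m j : ℕ)
  /-- read the next integer of the input into `X_i` -/
  | read (i : ℕ)
  /-- append `X_i` to the output -/
  | print (i : ℕ)

/-- A program is a finite list of instructions, numbered from `0`. -/
abbrev Program : Type := List Instr

/-- A configuration: the number of the next instruction, the contents of the registers, the unread
part of the input, and the output written so far. -/
structure Config : Type where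
  pc : ℕ
  reg : ℕ → ℤ
  input : List ℤ
  output : List ℤ

/-- At the start all registers hold `0`. -/
def initial (input : List ℤ) : Config where
  pc := 0
  reg := fun _ => 0
  input := input
  output := []

/-- The execution of one instruction. There is no next configuration if there is no instruction
with the number `c.pc` or if the instruction refers to a negative address. Reading beyond the end
of the input gives `0`. -/
def step (P : Program) (c : Config) : Option Config :=
  match P[c.pc]? with
  | none => none
  | some (Instr.const i k) =>
      some { c with pc := c.pc + 1, reg := Function.update c.reg i k }
  | some (Instr.add i j k) =>
      some { c with pc := c.pc + 1, reg := Function.update c.reg i (c.reg j + c.reg k) }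
  | some (Instr.sub i j k) =>
      some { c with pc := c.pc + 1, reg := Function.update c.reg i (c.reg j - c.reg k) }
  | some (Instr.load i j) =>
      if 0 ≤ c.reg j then
        some { c with
          pc := c.pc + 1, reg := Function.update c.reg i (c.reg (c.reg j).toNat) }
      else none
  | some (Instr.store i j) =>
      if 0 ≤ c.reg i then
        some { c with
          pc := c.pc + 1, reg := Function.update c.reg (c.reg i).toNat (c.reg j) }
      else none
  | some (Instr.jumpPos m j) =>
      some { c with pc := if 0 < c.reg j then m else c.pc + 1 }
  | some (Instr.read i) =>
      some { c with
        pc := c.pc + 1, reg := Function.update c.reg i (c.input.headD 0), input := c.input.tail }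
  | some (Instr.print i) =>
      some { c with pc := c.pc + 1, output := c.output ++ [c.reg i] }

/-- The configuration after exactly `t` executed instructions, if there is one. -/
def run (P : Program) : ℕ → Config → Option Config
  | 0, c => some c
  | t + 1, c => (step P c).bind (run P t)

/-- On the given input, `P` executes exactly `t` instructions, then leaves the program (that is,
halts), and has written exactly the given output. -/
def HaltsWith (P : Program) (input output : List ℤ) (t : ℕ) : Prop :=
  ∃ c : Config, run P t (initial input) = some c ∧ P.length ≤ c.pc ∧ c.output = output

end RAM

/-! The left formula `A` is itself a tree. Each occurrence of a modality is a node, joined by an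
edge with that modality to the nearest enclosing modality, or to a root if there is none; a variable
belongs to the node above it. Closing the edges under the frame conditions of `RCω`, and carrying
variables up along `ω`-edges, gives a model of the logic. `Arena.Dia` and `Arena.Var` define truth
in this closure inductively on the bare tree, without adding edges.

A sequent `A ⊢ B` is derivable exactly when `B` is true at the root (`Arena.derivable_iff_holds`).
Soundness is `Arena.Holds.of_derivable`, together with the truth of `A` at the root of its own tree
(`Arena.Placed.holds`). For completeness the nodes receive theories: the consequences of `A` at the
root, and below each edge a theory accessible from the one above (`IsTheory.exists_accessible`).
Truth is defined inductively, hence as small as possible, so a formula true at a node belongs to its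
theory (`Arena.Holds.mem`).

Truth at the root is computed by reading `B` from right to left with a stack of truth arrays, one
entry per node. Each symbol costs time linear in the array size. For a diamond this holds because a
witness path can be chosen to go up first and then only down (`Arena.dia_iff_reach`), so one scan
from the leaves to the root and one scan back suffice; both are plain array scans since parents have
smaller addresses than children. The total time is quadratic, well below degree four.

The machine program is compiled from a small structured language. Its weakest preconditions contain
a clock `time` that bounds the number of executed instructions, and `Structured.Cmd.runsTo_of_wp`
transfers results and clock to the machine. -/

namespace RCOmega

/-! ### Tree models and soundness. -/

open Formula Token

/-- A tree whose nodes are integers: `lab y` is the token at `y`, and `par y` is the parent of `y`.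
Only nodes that carry modalities or letters are joined to their parents. -/
structure Arena where
  par : ℤ → ℤ
  lab : ℤ → Token
  last : ℤ
  modality_range : ∀ y γ, lab y = modality γ → 32 ≤ par y ∧ par y < y ∧ y ≤ last
  letter_range : ∀ y p, lab y = letter p → 32 ≤ par y ∧ par y < y ∧ y ≤ last

namespace Arena

variable (M : Arena)

/-- The nodes that see a node in `T` along the modality `α`. -/
inductive Dia (α : Modality) (T : ℤ → Prop) : ℤ → Prop
  | child {y : ℤ} {γ : Modality} : M.lab y = modality γ → α ≤ γ → T y → Dia α T (M.par y)
  | desc {y : ℤ} {γ : Modality} :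
      M.lab y = modality γ → α ≤ γ → Dia α T y → Dia α T (M.par y)
  | up {y : ℤ} {γ : Modality} : M.lab y = modality γ → α < γ → Dia α T (M.par y) → Dia α T y

/-- The nodes at which the variable `p` is true. -/
inductive Var (p : ℕ) : ℤ → Prop
  | own {y : ℤ} : M.lab y = letter p → Var p (M.par y)
  | persist {y : ℤ} : M.lab y = modality ⊤ → Var p y → Var p (M.par y)

/-- Truth of a formula at a node. -/
def Holds : Formula → ℤ → Prop
  | var p => M.Var p
  | top => fun x => 32 ≤ x ∧ x ≤ M.last
  | conj A B => fun x => Holds A x ∧ Holds B x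
  | dia α A => M.Dia α (Holds A)

variable {M}

theorem Dia.range {α : Modality} {T : ℤ → Prop} {x : ℤ} (h : M.Dia α T x) :
    32 ≤ x ∧ x ≤ M.last := by
  induction h with
  | child h => have := M.modality_range _ _ h; omega
  | desc h => have := M.modality_range _ _ h; omega
  | up h => have := M.modality_range _ _ h; omega

theorem Var.range {p : ℕ} {x : ℤ} (h : M.Var p x) : 32 ≤ x ∧ x ≤ M.last := by
  induction h with
  | own h => have := M.letter_range _ _ h; omega
  | persist h => have := M.modality_range _ _ h; omega

theorem Holds.range {A : Formula} {x : ℤ} (h : M.Holds A x) : 32 ≤ x ∧ x ≤ M.last := by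
  induction A with
  | var p => exact Var.range h
  | top => exact h
  | conj A B ihA _ => exact ihA h.1
  | dia α A _ => exact Dia.range h

theorem Dia.mono {α : Modality} {T U : ℤ → Prop} (hTU : ∀ y, T y → U y) {x : ℤ}
    (h : M.Dia α T x) : M.Dia α U x := by
  induction h with
  | child h hle hT => exact .child h hle (hTU _ hT)
  | desc h hle _ ih => exact .desc h hle ih
  | up h hlt _ ih => exact .up h hlt ih

theorem Dia.weaken {α β : Modality} (hβ : β ≤ α) {T : ℤ → Prop} {x : ℤ}
    (h : M.Dia α T x) : M.Dia β T x := by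
  induction h with
  | child h hle hT => exact .child h (hβ.trans hle) hT
  | desc h hle _ ih => exact .desc h (hβ.trans hle) ih
  | up h hlt _ ih => exact .up h (hβ.trans_lt hlt) ih

theorem Dia.outer {α β : Modality} (hβ : β ≤ α) {T : ℤ → Prop} {x : ℤ}
    (h : M.Dia α (M.Dia β T) x) : M.Dia β T x := by
  induction h with
  | child h hle hT => exact .desc h (hβ.trans hle) hT
  | desc h hle _ ih => exact .desc h (hβ.trans hle) ih
  | up h hlt _ ih => exact .up h (hβ.trans_lt hlt) ih

theorem Dia.inner {α β : Modality} (hβ : β ≤ α) {T : ℤ → Prop} {x : ℤ}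
    (h : M.Dia β (M.Dia α T) x) : M.Dia β T x :=
  Dia.outer le_rfl (h.mono fun _ => Dia.weaken hβ)

/-- A `β`-diamond with `β < α` is invariant along every edge that an `α`-path uses: `up` carries it
to the child and `desc` to the parent. So it follows the path to the witness of `T`. -/
theorem Dia.conj {α β : Modality} (hβ : β < α) {T U : ℤ → Prop} {x : ℤ}
    (h : M.Dia α T x) (hU : M.Dia β U x) : M.Dia α (fun y => T y ∧ M.Dia β U y) x := by
  induction h with
  | child h hle hT => exact .child h hle ⟨hT, .up h (hβ.trans_le hle) hU⟩
  | desc h hle _ ih => exact .desc h hle (ih (.up h (hβ.trans_le hle) hU))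
  | up h hlt _ ih => exact .up h hlt (ih (.desc h (hβ.trans hlt).le hU))

/-- This is what makes `ωA ⊢ A` sound: a path for `ω` uses only `ω`-edges downwards, and `up` would
need a modality above `ω`. -/
theorem Holds.persist {y : ℤ} (hy : M.lab y = modality ⊤) {A : Formula} (h : M.Holds A y) :
    M.Holds A (M.par y) := by
  induction A with
  | var p => exact Var.persist hy h
  | top => have := M.modality_range _ _ hy; exact ⟨by omega, by omega⟩
  | conj A B ihA ihB => exact ⟨ihA h.1, ihB h.2⟩
  | dia α A _ => exact .desc hy le_top h

/-- Every tree is a model of `RCω`. -/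
theorem Holds.of_derivable {A B : Formula} (h : Derivable A B) :
    ∀ {x : ℤ}, M.Holds A x → M.Holds B x := by
  induction h with
  | refl => exact id
  | top_right => exact Holds.range
  | syllogism _ _ ih₁ ih₂ => exact fun h => ih₂ (ih₁ h)
  | conj_left => exact And.left
  | conj_right => exact And.right
  | conj_intro _ _ ih₁ ih₂ => exact fun h => ⟨ih₁ h, ih₂ h⟩
  | dia_mono α _ ih => exact fun h => Dia.mono (fun _ => ih) h
  | dia_dia => exact Dia.outer le_rfl
  | dia_outer _ hβ => exact Dia.outer hβ
  | dia_inner _ hβ => exact Dia.inner hβ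
  | dia_conj _ _ hβ => exact fun h => Dia.conj hβ h.1 h.2
  | monotonicity _ hβ => exact Dia.weaken hβ.le
  | persistence A =>
    intro x h
    change M.Dia ⊤ (M.Holds A) x at h
    induction h with
    | child h hle hT => exact .persist (top_le_iff.1 hle ▸ h) hT
    | desc h hle _ ih => exact .persist (top_le_iff.1 hle ▸ h) ih
    | up h hlt => exact absurd hlt not_top_lt

end Arena

/-! ### Completeness by theories. -/

/-- A set of formulas closed under derivability and conjunction. -/
structure IsTheory (Γ : Set Formula) : Prop where
  top_mem : top ∈ Γ
  conj_mem : ∀ {A B}, A ∈ Γ → B ∈ Γ → conj A B ∈ Γ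
  mem_of_derivable : ∀ {A B}, A ∈ Γ → Derivable A B → B ∈ Γ

theorem isTheory_derivable (A : Formula) : IsTheory {B | Derivable A B} where
  top_mem := .top_right A
  conj_mem := .conj_intro
  mem_of_derivable := .syllogism

/-- Accessibility of theories along the modality `α`. -/
structure Accessible (α : Modality) (Γ Δ : Set Formula) : Prop where
  dia_mem : ∀ {C}, C ∈ Δ → dia α C ∈ Γ
  mem_of_lt : ∀ {β C}, β < α → dia β C ∈ Γ → dia β C ∈ Δ

theorem Derivable.conj_mono {A B C D : Formula} (h₁ : Derivable A C) (h₂ : Derivable B D) :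
    Derivable (conj A B) (conj C D) :=
  .conj_intro (.syllogism (.conj_left A B) h₁) (.syllogism (.conj_right A B) h₂)

theorem Derivable.conj_assoc (A B C : Formula) :
    Derivable (conj A (conj B C)) (conj (conj A B) C) :=
  .conj_intro (.conj_mono (.refl A) (.conj_left B C))
    (.syllogism (.conj_right _ _) (.conj_right B C))

/-- The existence lemma of a canonical model construction. Without negation no maximality is needed:
the consequences of `A` and of those members of `Γ` that may be moved under `α` suffice. -/
theorem IsTheory.exists_accessible {Γ : Set Formula} (hΓ : IsTheory Γ) {α : Modality}
    {A : Formula} (hA : dia α A ∈ Γ) : ∃ Δ, IsTheory Δ ∧ Accessible α Γ Δ ∧ A ∈ Δ := by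
  -- `Fixed` formulas can be pulled under `α`. They contain `⊤`, are closed under conjunction, and
  -- contain `βC` for `β < α` by `dia_conj`. That they can be pulled in next to `A` yields
  -- `dia_mem`; that all `βC` are among them yields `mem_of_lt`.
  let Fixed (G : Formula) : Prop :=
    ∀ F, Derivable (conj (dia α F) G) (dia α (conj F G))
  have fixed_top : Fixed top := fun F =>
    .syllogism (.conj_left _ _) (.dia_mono α (.conj_intro (.refl F) (.top_right F)))
  refine ⟨{C | ∃ G ∈ Γ, Fixed G ∧ Derivable (conj A G) C}, ⟨?_, ?_, ?_⟩, ⟨?_, ?_⟩, ?_⟩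
  · exact ⟨top, hΓ.top_mem, fixed_top, .top_right _⟩
  · rintro C D ⟨G, hG, fG, hC⟩ ⟨H, hH, fH, hD⟩
    refine ⟨conj G H, hΓ.conj_mem hG hH, fun F => ?_, .conj_intro ?_ ?_⟩
    · refine .syllogism (.conj_assoc _ _ _) (.syllogism (.conj_mono (fG F) (.refl H))
        (.syllogism (fH _) (.dia_mono α (.conj_intro ?_ ?_))))
      · exact .syllogism (.conj_left _ _) (.conj_left _ _)
      · exact .conj_mono (.conj_right _ _) (.refl H)
    · exact .syllogism (.conj_mono (.refl A) (.conj_left _ _)) hC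
    · exact .syllogism (.conj_mono (.refl A) (.conj_right _ _)) hD
  · rintro C D ⟨G, hG, fG, hC⟩ hCD
    exact ⟨G, hG, fG, .syllogism hC hCD⟩
  · rintro C ⟨G, hG, fG, hC⟩
    exact hΓ.mem_of_derivable (hΓ.conj_mem hA hG) (.syllogism (fG A) (.dia_mono α hC))
  · exact fun {β C} hβ hC => ⟨_, hC, fun F => .dia_conj F C hβ, .conj_right _ _⟩
  · exact ⟨top, hΓ.top_mem, fixed_top, .conj_left _ _⟩

namespace Arena

variable {M : Arena}

/-- The assignment `f` of theories to nodes is compatible with the token at `y`. -/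
structure Compatible (M : Arena) (f : ℤ → Set Formula) (y : ℤ) : Prop where
  accessible : ∀ {γ}, M.lab y = modality γ → Accessible γ (f (M.par y)) (f y)
  var_mem : ∀ {p}, M.lab y = letter p → Formula.var p ∈ f (M.par y)

/-- Each rule that makes a formula true in the tree is matched by an axiom: `child` by monotonicity,
`desc` by `dia_outer`, `up` by the clause `mem_of_lt`, and the passage of variables along `ω` by
persistence. Only this half of a truth lemma is needed. -/
theorem Holds.mem {f : ℤ → Set Formula} (hf : ∀ x, IsTheory (f x))
    (hM : ∀ y, M.Compatible f y) {C : Formula} : ∀ {x : ℤ}, M.Holds C x → C ∈ f x := by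
  induction C with
  | var p =>
    intro x h
    change M.Var p x at h
    induction h with
    | own h => exact (hM _).var_mem h
    | persist h _ ih =>
      exact (hf _).mem_of_derivable (((hM _).accessible h).dia_mem ih) (.persistence _)
  | top => exact fun _ => (hf _).top_mem
  | conj A B ihA ihB => exact fun h => (hf _).conj_mem (ihA h.1) (ihB h.2)
  | dia α A ihA =>
    intro x h
    change M.Dia α (M.Holds A) x at h
    induction h with
    | child h hle hT =>
      have := ((hM _).accessible h).dia_mem (ihA hT)
      rcases hle.eq_or_lt with rfl | hlt
      · exact this
      · exact (hf _).mem_of_derivable this (.monotonicity _ hlt)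
    | desc h hle _ ih =>
      exact (hf _).mem_of_derivable (((hM _).accessible h).dia_mem ih) (.dia_outer _ hle)
    | up h hlt _ ih => exact ((hM _).accessible h).mem_of_lt hlt ih

/-- The tokens of the formula stand in the tree from `pos` on, below the node `cur`. -/
def Placed (par : ℤ → ℤ) (lab : ℤ → Token) : Formula → ℤ → ℤ → Prop
  | .var p, pos, cur => lab pos = letter p ∧ par pos = cur
  | .top, pos, _ => lab pos = verum
  | .conj A B, pos, cur =>
    lab pos = lparen ∧ Placed par lab A (pos + 1) cur ∧ lab (pos + 1 + A.length) = wedge ∧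
      Placed par lab B (pos + 1 + A.length + 1) cur ∧
      lab (pos + 1 + A.length + 1 + B.length) = rparen
  | .dia α A, pos, cur =>
    lab pos = modality α ∧ par pos = cur ∧ Placed par lab A (pos + 1) pos

end Arena

theorem Formula.length_conj (A B : Formula) :
    (conj A B).length = A.length + B.length + 3 := by
  simp [Formula.length, Formula.tokens]; omega

theorem Formula.length_dia (α : Modality) (A : Formula) :
    (dia α A).length = A.length + 1 := by
  simp [Formula.length, Formula.tokens]

namespace Arena

variable {M : Arena}

theorem Placed.holds {A : Formula} : ∀ {pos cur : ℤ}, 32 ≤ cur → cur ≤ M.last →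
    Placed M.par M.lab A pos cur → M.Holds A cur := by
  induction A with
  | var p => rintro pos cur _ _ ⟨h, rfl⟩; exact .own h
  | top => exact fun h₁ h₂ _ => ⟨h₁, h₂⟩
  | conj A B ihA ihB =>
    rintro pos cur h₁ h₂ ⟨-, hA, -, hB, -⟩
    exact ⟨ihA h₁ h₂ hA, ihB h₁ h₂ hB⟩
  | dia α A ih =>
    rintro pos cur h₁ h₂ ⟨h, rfl, hA⟩
    have := M.modality_range _ _ h
    exact .child h le_rfl (ih (by omega) (by omega) hA)

theorem Compatible.of_not_node {f : ℤ → Set Formula} {y : ℤ}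
    (h₁ : ∀ γ, M.lab y ≠ modality γ) (h₂ : ∀ p, M.lab y ≠ letter p) : M.Compatible f y :=
  ⟨fun h => absurd h (h₁ _), fun h => absurd h (h₂ _)⟩

/-- Compatibility at `y` involves only `y` and its parent, which is smaller. Later choices of
theories therefore do not disturb it. -/
theorem Compatible.congr {f g : ℤ → Set Formula} {y : ℤ} (h : M.Compatible f y)
    (hfg : ∀ x ≤ y, g x = f x) : M.Compatible g y where
  accessible {γ} hγ := by
    have := M.modality_range _ _ hγ
    rw [hfg _ this.2.1.le, hfg _ le_rfl]
    exact h.accessible hγ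
  var_mem {p} hp := by
    have := M.letter_range _ _ hp
    rw [hfg _ this.2.1.le]
    exact h.var_mem hp

/-- The theories are chosen from left to right. A subformula changes the assignment only from its
own position on; `cur < pos` keeps the theory of its parent node intact. -/
theorem Placed.exists_theories {A : Formula} : ∀ {pos cur : ℤ} {f : ℤ → Set Formula},
    cur < pos → Placed M.par M.lab A pos cur → (∀ x, IsTheory (f x)) → A ∈ f cur →
    ∃ g : ℤ → Set Formula, (∀ x, IsTheory (g x)) ∧ (∀ x < pos, g x = f x) ∧
      ∀ y, pos ≤ y → y < pos + A.length → M.Compatible g y := by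
  induction A with
  | var p =>
    rintro pos cur f hlt ⟨h, rfl⟩ hf hA
    refine ⟨f, hf, fun _ _ => rfl, fun y h₁ h₂ => ?_⟩
    obtain rfl : y = pos := by simp [Formula.length, Formula.tokens] at h₂; omega
    exact ⟨fun h' => by simp [h] at h', fun h' => by simp_all⟩
  | top =>
    intro pos cur f hlt h hf hA
    refine ⟨f, hf, fun _ _ => rfl, fun y h₁ h₂ => ?_⟩
    obtain rfl : y = pos := by simp [Formula.length, Formula.tokens] at h₂; omega
    change M.lab y = verum at h
    exact .of_not_node (by simp [h]) (by simp [h])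
  | conj A B ihA ihB =>
    rintro pos cur f hlt ⟨h₁, hA, h₂, hB, h₃⟩ hf hAB
    obtain ⟨g, hg, hgf, hgA⟩ := ihA (by omega) hA hf
      ((hf _).mem_of_derivable hAB (.conj_left _ _))
    obtain ⟨k, hk, hkg, hkB⟩ := ihB (by omega) hB hg
      (by rw [hgf _ (by omega)]; exact (hf _).mem_of_derivable hAB (.conj_right _ _))
    refine ⟨k, hk, fun x hx => by rw [hkg _ (by omega), hgf _ (by omega)], fun y hy hy' => ?_⟩
    rw [Formula.length_conj] at hy'
    push_cast at hy'
    rcases (show y = pos ∨ (pos + 1 ≤ y ∧ y < pos + 1 + A.length) ∨ y = pos + 1 + A.length ∨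
        (pos + 1 + A.length + 1 ≤ y ∧ y < pos + 1 + A.length + 1 + B.length) ∨
        y = pos + 1 + A.length + 1 + B.length by omega) with rfl | h | rfl | h | rfl
    · exact .of_not_node (by simp [h₁]) (by simp [h₁])
    · exact (hgA y h.1 h.2).congr fun x hx => hkg x (by omega)
    · exact .of_not_node (by simp [h₂]) (by simp [h₂])
    · exact hkB y h.1 h.2
    · exact .of_not_node (by simp [h₃]) (by simp [h₃])
  | dia α A ih =>
    rintro pos cur f hlt ⟨h, rfl, hA⟩ hf hmem
    obtain ⟨Δ, hΔ, hacc, hAΔ⟩ := (hf _).exists_accessible hmem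
    obtain ⟨g, hg, hgf, hgA⟩ := ih (f := Function.update f pos Δ) (by omega) hA
      (fun x => by
        rcases eq_or_ne x pos with rfl | hx
        · simpa using hΔ
        · simpa [hx] using hf x) (by simpa using hAΔ)
    refine ⟨g, hg, fun x hx => ?_, fun y hy hy' => ?_⟩
    · rw [hgf x (by omega), Function.update_of_ne (by omega)]
    · rw [Formula.length_dia] at hy'
      push_cast at hy'
      rcases hy.eq_or_lt with rfl | hy
      · refine ⟨fun {γ} h' => ?_, fun h' => by simp [h] at h'⟩
        obtain rfl : α = γ := by simpa [h] using h'
        rw [hgf _ (by omega), hgf _ (by omega), Function.update_self,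
          Function.update_of_ne (by omega)]
        exact hacc
      · exact hgA y (by omega) (by omega)

/-- The tree of `A` decides derivability from `A`. -/
theorem derivable_iff_holds {A : Formula} (hA : Placed M.par M.lab A 33 32)
    (hlast : M.last = 32 + A.length) (B : Formula) : Derivable A B ↔ M.Holds B 32 := by
  refine ⟨fun h => (hA.holds le_rfl (by omega)).of_derivable h, fun h => ?_⟩
  obtain ⟨g, hg, hg₀, hgA⟩ := hA.exists_theories (f := fun _ => {B | Derivable A B})
    (by omega) (fun _ => isTheory_derivable A) (Derivable.refl A)
  have := h.mem hg fun y => ?_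
  · rwa [hg₀ _ (by omega)] at this
  -- Away from the symbols of `A` there are no nodes, by the range conditions of an arena, so
  -- compatibility is vacuous there.
  · by_cases hy : 33 ≤ y ∧ y < 33 + A.length
    · exact hgA y hy.1 hy.2
    · refine ⟨fun h => ?_, fun h => ?_⟩
      · have := M.modality_range _ _ h; omega
      · have := M.letter_range _ _ h; omega

end Arena

end RCOmega

/-! ### Structured programs with a clock. -/

namespace RAM

theorem run_add (P : Program) (t u : ℕ) (c : Config) :
    run P (t + u) c = (run P t c).bind (run P u) := by
  induction t generalizing c with
  | zero => simp [run]
  | succ t ih =>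
    rw [Nat.succ_add]
    simp only [run, Option.bind_assoc]
    congr 1
    funext d
    exact ih d

theorem run_one (P : Program) (c : Config) : run P 1 c = step P c := by
  cases h : step P c <;> simp [run, h]

end RAM

namespace Structured

open RAM

/-- Variables that live through a whole phase of the program. -/
inductive Global : Type
  | one | zero | stride | finish | omega | base | ptr | code | flag | cur | top
  deriving DecidableEq

/-- Variables of inner loops. -/
inductive Temp : Type
  | node | count | sym | val | parent | scratch | aux
  deriving DecidableEq

inductive Var : Type
  | g (x : Global)
  | t (x : Temp)

def Global.idx : Global → ℕ
  | one => 1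
  | zero => 2
  | stride => 3
  | finish => 4
  | omega => 5
  | base => 6
  | ptr => 7
  | code => 8
  | flag => 9
  | cur => 10
  | top => 11

def Temp.idx : Temp → ℕ
  | node => 20
  | count => 21
  | sym => 22
  | val => 23
  | parent => 24
  | scratch => 25
  | aux => 26

/-- The register of a variable. Register `0` is used by composite instructions only. -/
def Var.idx : Var → ℕ
  | g x => x.idx
  | t x => x.idx

theorem Var.idx_pos (x : Var) : 0 < x.idx := by
  rcases x with x | x <;> cases x <;> decide

theorem Var.idx_lt (x : Var) : x.idx < 32 := by
  rcases x with x | x <;> cases x <;> decide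

theorem Var.idx_injective : Function.Injective Var.idx := by
  rintro (x | x) (y | y) h <;> cases x <;> cases y <;>
    first | rfl | exact absurd h (by decide)

/-- The contents of the variables and of the heap, which consists of the addresses from `32` on. -/
structure State : Type where
  g : Global → ℤ
  t : Temp → ℤ
  mem : ℤ → ℤ
  input : List ℤ
  output : List ℤ
  time : ℤ

namespace State

def get (s : State) : Var → ℤ
  | .g x => s.g x
  | .t x => s.t x

def set (s : State) (x : Var) (a : ℤ) : State :=
  match x with
  | .g x => { s with g := Function.update s.g x a }
  | .t x => { s with t := Function.update s.t x a }

def tick (s : State) (n : ℤ) : State := { s with time := s.time + n }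

@[simp] theorem get_g (s : State) (x : Global) : s.get (.g x) = s.g x := rfl
@[simp] theorem get_t (s : State) (x : Temp) : s.get (.t x) = s.t x := rfl

/-- The condition compares register numbers, to match an update of the register file. -/
theorem get_set (s : State) (x y : Var) (a : ℤ) :
    (s.set x a).get y = if y.idx = x.idx then a else s.get y := by
  by_cases h : y = x
  · subst h
    cases y <;> simp [set, get]
  · rw [if_neg (Var.idx_injective.ne h)]
    rcases x with x | x <;> rcases y with y | y <;>
      simp_all [set, get]

@[simp] theorem mem_set (s : State) (x : Var) (a : ℤ) : (s.set x a).mem = s.mem := by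
  cases x <;> rfl

@[simp] theorem input_set (s : State) (x : Var) (a : ℤ) : (s.set x a).input = s.input := by
  cases x <;> rfl

@[simp] theorem output_set (s : State) (x : Var) (a : ℤ) :
    (s.set x a).output = s.output := by
  cases x <;> rfl

@[simp] theorem time_set (s : State) (x : Var) (a : ℤ) : (s.set x a).time = s.time := by
  cases x <;> rfl

end State

/-- Composite instructions. -/
inductive Op : Type
  | const (x : Var) (k : ℤ)
  | add (x y z : Var)
  | addConst (x y : Var) (k : ℤ)
  | sub (x y z : Var)
  | constSub (x : Var) (k : ℤ) (y : Var)
  | load (x y z : Var)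
  | store (y z x : Var)
  | read (x : Var)
  | print (x : Var)

/-- The heap after `v` has been written to the address `a`. -/
def write (m : ℤ → ℤ) (a v : ℤ) : ℤ → ℤ := Function.update m a v

theorem write_apply (m : ℤ → ℤ) (a v b : ℤ) : write m a v b = if b = a then v else m b :=
  Function.update_apply ..

namespace Op

def code : Op → List Instr
  | const x k => [.const x.idx k]
  | add x y z => [.add x.idx y.idx z.idx]
  | addConst x y k => [.const 0 k, .add x.idx y.idx 0]
  | sub x y z => [.sub x.idx y.idx z.idx]
  | constSub x k y => [.const 0 k, .sub x.idx 0 y.idx]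
  | load x y z => [.add 0 y.idx z.idx, .load x.idx 0]
  | store y z x => [.add 0 y.idx z.idx, .store 0 x.idx]
  | read x => [.read x.idx]
  | print x => [.print x.idx]

/-- Heap addresses have to be at least `32`. -/
def Ok (s : State) : Op → Prop
  | load _ y z => 32 ≤ s.get y + s.get z
  | store y z _ => 32 ≤ s.get y + s.get z
  | _ => True

/-- Every operation is charged 2, the largest number of instructions in its code; `time` is only an
upper bound. -/
def apply (s : State) : Op → State
  | const x k => (s.set x k).tick 2
  | add x y z => (s.set x (s.get y + s.get z)).tick 2
  | addConst x y k => (s.set x (s.get y + k)).tick 2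
  | sub x y z => (s.set x (s.get y - s.get z)).tick 2
  | constSub x k y => (s.set x (k - s.get y)).tick 2
  | load x y z => (s.set x (s.mem (s.get y + s.get z))).tick 2
  | store y z x =>
    { s with mem := write s.mem (s.get y + s.get z) (s.get x) }.tick 2
  | read x => { s.set x (s.input.headD 0) with input := s.input.tail }.tick 2
  | print x => { s with output := s.output ++ [s.get x] }.tick 2

end Op

/-- Structured programs. -/
inductive Cmd : Type
  | op (o : Op)
  | seq (c d : Cmd)
  | ite (x : Var) (c d : Cmd)
  | loop (x : Var) (c : Cmd)

namespace Cmd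

/-- The machine program for a command whose first instruction has the number `start`. -/
def compile : Cmd → ℕ → Program
  | op o, _ => o.code
  | seq c d, start => c.compile start ++ d.compile (start + (c.compile start).length)
  | ite x c d, start =>
    let e := d.compile (start + 1)
    let f := c.compile (start + 1 + e.length + 2)
    [.jumpPos (start + 1 + e.length + 2) x.idx] ++ e ++
      [.const 0 1, .jumpPos (start + 1 + e.length + 2 + f.length) 0] ++ f
  | loop x c, start =>
    let e := c.compile (start + 2)
    [.const 0 1, .jumpPos (start + 2 + e.length) 0] ++ e ++ [.jumpPos (start + 2) x.idx]

/-- Weakest preconditions, with an invariant for each loop. -/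
def wp : Cmd → (State → Prop) → State → Prop
  | op o, Q, s => o.Ok s ∧ Q (o.apply s)
  | seq c d, Q, s => wp c (wp d Q) s
  | ite x c d, Q, s =>
    (0 < s.get x → wp c Q (s.tick 3)) ∧ (s.get x ≤ 0 → wp d Q (s.tick 3))
  | loop x c, Q, s => ∃ I : ℕ → State → Prop, (∃ n, I n (s.tick 3)) ∧
    ∀ n s, I n s → (0 < s.get x → wp c (fun s' => ∃ k < n, I k s') (s.tick 1)) ∧
      (s.get x ≤ 0 → Q s)

theorem wp_op {o : Op} {Q : State → Prop} {s : State} :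
    (op o).wp Q s ↔ o.Ok s ∧ Q (o.apply s) := Iff.rfl

theorem wp_seq {c d : Cmd} {Q : State → Prop} {s : State} :
    (seq c d).wp Q s ↔ c.wp (d.wp Q) s := Iff.rfl

theorem wp_ite {x : Var} {c d : Cmd} {Q : State → Prop} {s : State} :
    (ite x c d).wp Q s ↔
      (0 < s.get x → wp c Q (s.tick 3)) ∧ (s.get x ≤ 0 → wp d Q (s.tick 3)) := Iff.rfl

theorem wp_mono {c : Cmd} : ∀ {Q R : State → Prop} {s : State}, c.wp Q s →
    (∀ s, Q s → R s) → c.wp R s := by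
  induction c with
  | op o => exact fun h hQR => ⟨h.1, hQR _ h.2⟩
  | seq c d ihc ihd => exact fun h hQR => ihc h fun s hs => ihd hs hQR
  | ite x c d ihc ihd =>
    exact fun h hQR => ⟨fun hx => ihc (h.1 hx) hQR, fun hx => ihd (h.2 hx) hQR⟩
  | loop x c =>
    rintro Q R s ⟨I, h₀, hI⟩ hQR
    exact ⟨I, h₀, fun n s h => ⟨(hI n s h).1, fun hx => hQR _ ((hI n s h).2 hx)⟩⟩

theorem wp_seq_of (R : State → Prop) {c d : Cmd} {Q : State → Prop} {s : State}
    (hc : c.wp R s) (hd : ∀ s, R s → d.wp Q s) : (seq c d).wp Q s := by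
  exact wp_mono (c := c) hc hd

/-- A loop that is executed as often as its control variable says. -/
theorem wp_loop {x : Var} {c : Cmd} {Q : State → Prop} {s : State} (I : ℕ → State → Prop)
    (n : ℕ) (h₀ : I n (s.tick 3)) (hx : ∀ n s, I n s → (0 < s.get x ↔ 0 < n))
    (hI : ∀ n s, I (n + 1) s → c.wp (I n) (s.tick 1)) (hQ : ∀ s, I 0 s → Q s) :
    (loop x c).wp Q s := by
  refine ⟨I, ⟨n, h₀⟩, fun n s hn => ⟨fun hpos => ?_, fun hneg => ?_⟩⟩
  · obtain ⟨k, rfl⟩ : ∃ k, n = k + 1 := Nat.exists_eq_succ_of_ne_zero ((hx n s hn).1 hpos).ne'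
    exact wp_mono (hI k s hn) fun s hs => ⟨k, by omega, hs⟩
  · obtain rfl : n = 0 := by
      by_contra h
      have := (hx n s hn).2 (by omega)
      omega
    exact hQ s hn

end Cmd

/-! ### Correctness of compilation. -/

/-- A machine configuration that represents the state `s`. -/
structure Represents (s : State) (c : Config) : Prop where
  reg_idx : ∀ x : Var, c.reg x.idx = s.get x
  reg_heap : ∀ a : ℕ, 32 ≤ a → c.reg a = s.mem a
  input_eq : c.input = s.input
  output_eq : c.output = s.output

namespace Represents

variable {s : State} {c : Config}

theorem tick (h : Represents s c) (n : ℤ) (pc : ℕ) :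
    Represents (s.tick n) { c with pc := pc } := by
  obtain ⟨h₁, h₂, h₃, h₄⟩ := h
  exact ⟨fun x => by rw [h₁]; cases x <;> rfl, h₂, h₃, h₄⟩

theorem set_scratch (h : Represents s c) (a : ℤ) :
    Represents s { c with reg := Function.update c.reg 0 a } := by
  obtain ⟨h₁, h₂, h₃, h₄⟩ := h
  refine ⟨fun x => ?_, fun b hb => ?_, h₃, h₄⟩
  · exact (Function.update_of_ne x.idx_pos.ne' _ _).trans (h₁ x)
  · exact (Function.update_of_ne (by omega) _ _).trans (h₂ b hb)

theorem set_var (h : Represents s c) (x : Var) (a : ℤ) :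
    Represents (s.set x a) { c with reg := Function.update c.reg x.idx a } := by
  obtain ⟨h₁, h₂, h₃, h₄⟩ := h
  refine ⟨fun y => ?_, fun b hb => ?_, by simpa using h₃, by simpa using h₄⟩
  · rw [State.get_set, ← h₁]
    exact Function.update_apply ..
  · have := x.idx_lt
    rw [State.mem_set, ← h₂ b hb]
    exact Function.update_of_ne (by omega) _ _

theorem set_heap (h : Represents s c) {a : ℤ} (ha : 32 ≤ a) (b : ℤ) :
    Represents { s with mem := write s.mem a b }
      { c with reg := Function.update c.reg a.toNat b } := by
  obtain ⟨h₁, h₂, h₃, h₄⟩ := h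
  refine ⟨fun x => ?_, fun n hn => ?_, h₃, h₄⟩
  · have := x.idx_lt
    refine (Function.update_of_ne (by omega) _ _).trans ((h₁ x).trans ?_)
    cases x <;> rfl
  · simp only [write_apply, Function.update_apply, h₂ n hn]
    exact if_congr (by omega) rfl rfl

end Represents

theorem run_op {P : Program} {start : ℕ} {o : Op}
    (hP : ∀ i (h : i < o.code.length), P[start + i]? = some o.code[i])
    {s : State} {c : Config} (hs : Represents s c) (hc : c.pc = start) (ho : o.Ok s) :
    ∃ (t : ℕ) (c' : Config), run P t c = some c' ∧ Represents (o.apply s) c' ∧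
      c'.pc = start + o.code.length ∧ t + s.time ≤ (o.apply s).time := by
  subst hc
  cases o with
  | const x k =>
    have h₀ := hP 0 (by simp [Op.code])
    refine ⟨1, _, ?_, (hs.set_var x k).tick 2 (c.pc + 1), rfl, ?_⟩
    · simp [run_one, step, Op.code] at h₀ ⊢; simp [h₀]
    · simp [Op.apply, State.tick]; omega
  | add x y z =>
    have h₀ := hP 0 (by simp [Op.code])
    refine ⟨1, _, ?_, (hs.set_var x (s.get y + s.get z)).tick 2 (c.pc + 1), rfl, ?_⟩
    · simp [run_one, step, Op.code] at h₀ ⊢; simp [h₀, hs.reg_idx]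
    · simp [Op.apply, State.tick]; omega
  | sub x y z =>
    have h₀ := hP 0 (by simp [Op.code])
    refine ⟨1, _, ?_, (hs.set_var x (s.get y - s.get z)).tick 2 (c.pc + 1), rfl, ?_⟩
    · simp [run_one, step, Op.code] at h₀ ⊢; simp [h₀, hs.reg_idx]
    · simp [Op.apply, State.tick]; omega
  | addConst x y k =>
    have h₀ := hP 0 (by simp [Op.code])
    have h₁ := hP 1 (by simp [Op.code])
    refine ⟨2, _, ?_, ((hs.set_scratch k).set_var x (s.get y + k)).tick 2 (c.pc + 2), rfl, ?_⟩
    · simp [run, step, Op.code] at h₀ h₁ ⊢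
      simp [h₀, h₁, hs.reg_idx, y.idx_pos.ne']
    · simp [Op.apply, State.tick]; omega
  | constSub x k y =>
    have h₀ := hP 0 (by simp [Op.code])
    have h₁ := hP 1 (by simp [Op.code])
    refine ⟨2, _, ?_, ((hs.set_scratch k).set_var x (k - s.get y)).tick 2 (c.pc + 2), rfl, ?_⟩
    · simp [run, step, Op.code] at h₀ h₁ ⊢
      simp [h₀, h₁, hs.reg_idx, y.idx_pos.ne']
    · simp [Op.apply, State.tick]; omega
  | load x y z =>
    have h₀ := hP 0 (by simp [Op.code])
    have h₁ := hP 1 (by simp [Op.code])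
    change 32 ≤ s.get y + s.get z at ho
    have h₂ := hs.reg_heap (s.get y + s.get z).toNat (by omega)
    rw [Int.toNat_of_nonneg (by omega)] at h₂
    refine ⟨2, _, ?_, ((hs.set_scratch (s.get y + s.get z)).set_var x
      (s.mem (s.get y + s.get z))).tick 2 (c.pc + 2), rfl, ?_⟩
    · simp [run, step, Op.code] at h₀ h₁ ⊢
      have h₃ : 0 ≤ s.get y + s.get z := by omega
      have h₄ : (s.get y + s.get z).toNat ≠ 0 := by omega
      simp [h₀, h₁, hs.reg_idx, h₃, h₄, h₂]
    · simp [Op.apply, State.tick]; omega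
  | store y z x =>
    have h₀ := hP 0 (by simp [Op.code])
    have h₁ := hP 1 (by simp [Op.code])
    change 32 ≤ s.get y + s.get z at ho
    refine ⟨2, _, ?_, ((hs.set_scratch (s.get y + s.get z)).set_heap ho
      (s.get x)).tick 2 (c.pc + 2), rfl, ?_⟩
    · simp [run, step, Op.code] at h₀ h₁ ⊢
      have h₃ : 0 ≤ s.get y + s.get z := by omega
      simp [h₀, h₁, hs.reg_idx, h₃, x.idx_pos.ne']
    · simp [Op.apply, State.tick]; omega
  | read x =>
    have h₀ := hP 0 (by simp [Op.code])
    refine ⟨1, { c with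
      pc := c.pc + 1
      reg := Function.update c.reg x.idx (c.input.headD 0)
      input := c.input.tail }, ?_, ?_, rfl, ?_⟩
    · simp [run_one, step, Op.code] at h₀ ⊢; simp [h₀]
    · have := (hs.set_var x (s.input.headD 0)).tick 2 (c.pc + 1)
      rw [← hs.input_eq] at this
      refine ⟨fun y => ?_, fun a ha => (this.reg_heap a ha).trans ?_, ?_, this.output_eq.trans ?_⟩
      · refine (this.reg_idx y).trans ?_
        rw [hs.input_eq]
        cases x <;> cases y <;> rfl
      · simp [Op.apply, State.tick]
      · simp [Op.apply, State.tick, hs.input_eq]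
      · simp [Op.apply, State.tick]
    · simp [Op.apply, State.tick]; omega
  | print x =>
    have h₀ := hP 0 (by simp [Op.code])
    refine ⟨1, { c with pc := c.pc + 1, output := c.output ++ [c.reg x.idx] }, ?_, ?_, rfl, ?_⟩
    · simp [run_one, step, Op.code] at h₀ ⊢; simp [h₀]
    · refine ⟨fun y => ?_, hs.reg_heap, hs.input_eq, ?_⟩
      · refine (hs.reg_idx y).trans ?_
        cases y <;> rfl
      · simp [Op.apply, State.tick, hs.output_eq, hs.reg_idx]
    · simp [Op.apply, State.tick]; omega

/-- The program `Q` is a part of `P` that begins at `start`. -/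
def Within (Q P : Program) (start : ℕ) : Prop :=
  ∀ i (h : i < Q.length), P[start + i]? = some Q[i]

theorem Within.left {Q R P : Program} {start : ℕ} (h : Within (Q ++ R) P start) :
    Within Q P start := fun i hi => by
  rw [h i (by simp; omega), List.getElem_append_left hi]

theorem Within.right {Q R P : Program} {start : ℕ} (h : Within (Q ++ R) P start) :
    Within R P (start + Q.length) := fun i hi => by
  rw [add_assoc, h (Q.length + i) (by simp; omega), List.getElem_append_right (by omega)]
  simp

theorem Within.step_const {P : Program} {R : Program} {pc : ℕ} {i : ℕ} {k : ℤ}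
    (h : Within (.const i k :: R) P pc) {c : Config} (hc : c.pc = pc) :
    step P c = some { c with pc := pc + 1, reg := Function.update c.reg i k } := by
  have := h 0 (by simp)
  subst hc
  simp at this
  simp [step, this]

theorem Within.step_jumpPos {P : Program} {R : Program} {pc : ℕ} {m j : ℕ}
    (h : Within (.jumpPos m j :: R) P pc) {c : Config} (hc : c.pc = pc) :
    step P c = some { c with pc := if 0 < c.reg j then m else pc + 1 } := by
  have := h 0 (by simp)
  subst hc
  simp at this
  simp [step, this]

theorem Within.run_goto {P : Program} {R : Program} {pc m : ℕ}
    (h : Within (.const 0 1 :: .jumpPos m 0 :: R) P pc) {c : Config} (hc : c.pc = pc) :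
    run P 2 c = some { c with pc := m, reg := Function.update c.reg 0 1 } := by
  have h' : Within (.jumpPos m 0 :: R) P (pc + 1) :=
    Within.right (Q := [.const 0 1]) (R := .jumpPos m 0 :: R) h
  simp [run, h.step_const hc, h'.step_jumpPos]

namespace Cmd

/-- `RunsTo P s c pc Q`: from `c`, which represents `s`, the program `P` comes to the instruction
`pc` in a state that satisfies `Q`, within the time recorded there. -/
def RunsTo (P : Program) (s : State) (c : Config) (pc : ℕ) (Q : State → Prop) : Prop :=
  ∃ (t : ℕ) (s' : State) (c' : Config), run P t c = some c' ∧ Represents s' c' ∧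
    c'.pc = pc ∧ t + s.time ≤ s'.time ∧ Q s'

theorem RunsTo.trans {P : Program} {s : State} {c : Config} {pc pc' : ℕ} {Q R : State → Prop}
    (h : RunsTo P s c pc Q)
    (hR : ∀ s' c', Represents s' c' → c'.pc = pc → Q s' → RunsTo P s' c' pc' R) :
    RunsTo P s c pc' R := by
  obtain ⟨t, s₁, c₁, hrun, hrep, hpc, htime, hQ⟩ := h
  obtain ⟨u, s₂, c₂, hrun', hrep', hpc', htime', hR'⟩ := hR s₁ c₁ hrep hpc hQ
  exact ⟨t + u, s₂, c₂, by rw [run_add, hrun]; exact hrun', hrep', hpc',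
    by push_cast; omega, hR'⟩

theorem RunsTo.prepend {P : Program} {s : State} {c c' : Config} {pc t : ℕ} {n : ℤ}
    {Q : State → Prop} (hrun : run P t c = some c') (ht : t ≤ n)
    (h : RunsTo P (s.tick n) c' pc Q) : RunsTo P s c pc Q := by
  obtain ⟨u, s₂, c₂, hrun', hrep', hpc', htime', hQ⟩ := h
  simp only [State.tick] at htime'
  exact ⟨t + u, s₂, c₂, by rw [run_add, hrun]; exact hrun', hrep', hpc',
    by push_cast; omega, hQ⟩

theorem RunsTo.append {P : Program} {s : State} {c : Config} {pc pc' t : ℕ} {n : ℤ}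
    {Q : State → Prop} (h : RunsTo P (s.tick n) c pc Q) (ht : t ≤ n)
    (hrun : ∀ s' c', Represents s' c' → c'.pc = pc →
      ∃ c'', run P t c' = some c'' ∧ Represents s' c'' ∧ c''.pc = pc') :
    RunsTo P s c pc' Q := by
  obtain ⟨u, s₂, c₂, hrun', hrep', hpc', htime', hQ⟩ := h
  obtain ⟨c₃, h₃, hrep₃, hpc₃⟩ := hrun s₂ c₂ hrep' hpc'
  simp only [State.tick] at htime'
  exact ⟨u + t, s₂, c₃, by rw [run_add, hrun']; exact h₃, hrep₃, hpc₃,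
    by push_cast; omega, hQ⟩

/-- The clock of a state that satisfies the invariant already includes the final, failing test,
which has not yet been executed; hence the run is measured from `s.tick (-1)`. Every successful test
is paid by the `tick 1` in front of the body. -/
theorem runsTo_loop {P : Program} {x : Var} {body test : ℕ} {Q : State → Prop}
    {I : ℕ → State → Prop}
    (htest : ∀ s c, Represents s c → c.pc = test →
      run P 1 c = some { c with pc := if 0 < s.get x then body else test + 1 })
    (hbody : ∀ n s c, Represents s c → c.pc = body → I n s → 0 < s.get x →
      RunsTo P (s.tick 1) c test fun s' => ∃ k < n, I k s')
    (hQ : ∀ n s, I n s → s.get x ≤ 0 → Q s) (n : ℕ) :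
    ∀ s c, Represents s c → c.pc = test → I n s → RunsTo P (s.tick (-1)) c (test + 1) Q := by
  induction n using Nat.strong_induction_on with
  | _ n ih =>
    intro s c hs hc hI
    by_cases hx : 0 < s.get x
    · have h₁ := htest s c hs hc
      rw [if_pos hx] at h₁
      have hs' : Represents s { c with pc := body } := by
        simpa [State.tick] using hs.tick 0 body
      obtain ⟨u, s₁, c₁, hrun₁, hrep₁, hpc₁, htime₁, k, hk, hIk⟩ :=
        hbody n s _ hs' rfl hI hx
      obtain ⟨t, s₂, c₂, hrun₂, hrep₂, hpc₂, htime₂, hQ₂⟩ := ih k hk s₁ c₁ hrep₁ hpc₁ hIk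
      simp only [State.tick] at htime₁ htime₂
      refine ⟨1 + (u + t), s₂, c₂, ?_, hrep₂, hpc₂, ?_, hQ₂⟩
      · rw [run_add, h₁, Option.bind_some, run_add, hrun₁]
        exact hrun₂
      · simp only [State.tick]; push_cast; omega
    · have h₁ := htest s c hs hc
      rw [if_neg hx] at h₁
      have hs' : Represents s { c with pc := test + 1 } := by
        simpa [State.tick] using hs.tick 0 (test + 1)
      exact ⟨1, s, _, h₁, hs', rfl, by simp [State.tick], hQ n s hI (by omega)⟩

/-- Compiled commands do what the weakest preconditions say. -/
theorem runsTo_of_wp (P : Program) (a : Cmd) : ∀ {start : ℕ} {Q : State → Prop} {s : State}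
    {c : Config}, Within (a.compile start) P start → Represents s c → c.pc = start →
    a.wp Q s → RunsTo P s c (start + (a.compile start).length) Q := by
  induction a with
  | op o =>
    intro start Q s c hP hs hc h
    obtain ⟨t, c', h₁, h₂, h₃, h₄⟩ := run_op hP hs hc h.1
    exact ⟨t, _, c', h₁, h₂, h₃, h₄, h.2⟩
  | seq a b iha ihb =>
    intro start Q s c hP hs hc h
    refine (iha hP.left hs hc h).trans fun s' c' hs' hc' h' => ?_
    have := ihb hP.right hs' hc' h'
    simpa [compile, add_assoc] using this
  | ite x a b iha ihb =>
    intro start Q s c hP hs hc h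
    simp only [compile] at hP
    generalize he : b.compile (start + 1) = e at hP
    generalize hf : a.compile (start + 1 + e.length + 2) = f at hP
    have hlen : ((ite x a b).compile start).length = 1 + e.length + 2 + f.length := by
      simp only [compile, he, hf, List.length_append, List.length_cons, List.length_nil]
    rw [hlen]
    have h₀ : Within [.jumpPos (start + 1 + e.length + 2) x.idx] P start := hP.left.left.left
    have h₁ : Within e P (start + 1) := hP.left.left.right
    have h₂ := hP.left.right
    have h₃ := hP.right
    simp only [List.length_append, List.length_cons, List.length_nil] at h₂ h₃
    have hstep := h₀.step_jumpPos hc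
    rw [hs.reg_idx, ← run_one] at hstep
    by_cases hx : 0 < s.get x
    · rw [if_pos hx] at hstep
      refine .prepend hstep (n := 3) (by norm_num) ?_
      have := iha (start := start + 1 + e.length + 2)
        (by rw [hf]; convert h₃ using 1; omega) (hs.tick 3 _) rfl (h.1 hx)
      rw [hf] at this
      convert this using 1
      omega
    · rw [if_neg hx] at hstep
      -- One unit pays for the test, two for the jump over the other branch after this one.
      have hk : (s.tick 3) = (s.tick 1).tick 2 := by simp [State.tick, add_assoc]
      refine .prepend hstep (n := 1) (by norm_num) ?_
      have := ihb (start := start + 1) (by rw [he]; exact h₁) (hs.tick 3 _) rfl (h.2 (by omega))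
      rw [he, hk] at this
      refine this.append (t := 2) (by norm_num) fun s' c' hs' hc' => ?_
      refine ⟨_, h₂.run_goto (hc'.trans (by omega)), ?_, ?_⟩
      · simpa [State.tick] using (hs'.set_scratch 1).tick 0 (start + 1 + e.length + 2 + f.length)
      · simp only; omega
  | loop x a ih =>
    intro start Q s c hP hs hc h
    simp only [compile] at hP
    generalize he : a.compile (start + 2) = e at hP
    have hlen : ((loop x a).compile start).length = 2 + e.length + 1 := by
      simp only [compile, he, List.length_append, List.length_cons, List.length_nil]
    rw [hlen]
    have h₀ : Within [.const 0 1, .jumpPos (start + 2 + e.length) 0] P start := hP.left.left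
    have h₁ : Within e P (start + 2) := hP.left.right
    have h₂ : Within [.jumpPos (start + 2) x.idx] P (start + 2 + e.length) := by
      convert hP.right using 1
      simp; omega
    obtain ⟨I, ⟨n, hn⟩, hI⟩ := h
    -- Of the three units charged on entry, two pay for the jump to the test and the third for the
    -- last test.
    refine .prepend (h₀.run_goto hc) (n := 2) (by norm_num) ?_
    have := runsTo_loop (P := P) (x := x) (body := start + 2) (test := start + 2 + e.length)
      (Q := Q) (I := I) ?_ ?_ (fun n s h => (hI n s h).2) n (s.tick 3)
      { c with pc := start + 2 + e.length, reg := Function.update c.reg 0 1 }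
      ((hs.set_scratch 1).tick 3 _) rfl hn
    · have hk : (s.tick 3).tick (-1) = s.tick 2 := by simp [State.tick]; omega
      rw [hk] at this
      convert this using 1
      omega
    · intro s c hs hc
      rw [run_one, h₂.step_jumpPos hc, hs.reg_idx]
    · intro n s c hs hc hn hx
      have := ih (by rw [he]; exact h₁) (by simpa using hs.tick 1 c.pc) hc ((hI n s hn).1 hx)
      rwa [he] at this

theorem runsTo_initial {a : Cmd} {Q : State → Prop} {input : List ℤ}
    (h : a.wp Q ⟨fun _ => 0, fun _ => 0, fun _ => 0, input, [], 0⟩) :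
    ∃ (t : ℕ) (s : State), t ≤ s.time ∧ Q s ∧
      HaltsWith (a.compile 0) input s.output t := by
  obtain ⟨t, s, c, h₁, h₂, h₃, h₄, h₅⟩ := runsTo_of_wp (a.compile 0) a (start := 0)
    (c := initial input) (fun i hi => by simp [hi])
    ⟨fun x => by cases x <;> rfl, fun _ _ => rfl, rfl, rfl⟩ rfl h
  exact ⟨t, s, by simpa using h₄, h₅, c, h₁, by omega, h₂.output_eq⟩

end Cmd

end Structured

/-! ### Truth arrays and conjunction. -/

namespace Structured

open RCOmega Op Cmd Global Temp Var

infixr:60 " ;; " => Cmd.seq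

/-- A command without a lasting effect. -/
def skip : Cmd := op (const (t scratch) 0)

open Classical in
/-- Truth values as numbers. -/
noncomputable def ind (p : Prop) : ℤ := if p then 1 else 0

theorem ind_of_true {p : Prop} (h : p) : ind p = 1 := if_pos h
theorem ind_of_false {p : Prop} (h : ¬p) : ind p = 0 := if_neg h
theorem ind_congr {p q : Prop} (h : p ↔ q) : ind p = ind q := by rw [propext h]
theorem ind_pos {p : Prop} : 0 < ind p ↔ p := by
  unfold ind; split_ifs <;> simp_all
theorem ind_nonpos {p : Prop} : ind p ≤ 0 ↔ ¬p := by
  rw [← not_lt, ind_pos]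

/-- The array at `b`, with `S` entries, holds the truth values of `T`. -/
def Level (S : ℤ) (m : ℤ → ℤ) (b : ℤ) (T : ℤ → Prop) : Prop :=
  ∀ z, 0 ≤ z → z < S → m (b + z) = ind (T z)

theorem Level.congr {S : ℤ} {m : ℤ → ℤ} {b : ℤ} {T U : ℤ → Prop} (h : Level S m b T)
    (hTU : ∀ z, T z ↔ U z) : Level S m b U :=
  fun z h₁ h₂ => (h z h₁ h₂).trans (ind_congr (hTU z))

theorem Level.write_one {S : ℤ} {m : ℤ → ℤ} {b : ℤ} {T : ℤ → Prop} (h : Level S m b T)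
    (x : ℤ) : Level S (write m (b + x) 1) b fun z => T z ∨ x = z := by
  intro z h₁ h₂
  rw [write_apply]
  split_ifs with hz
  · rw [ind_of_true (.inr (by omega))]
  · rw [h z h₁ h₂]
    exact ind_congr ⟨.inl, fun h => h.resolve_right (by omega)⟩

theorem Level.write_ind {S : ℤ} {m : ℤ → ℤ} {b : ℤ} {T : ℤ → Prop} (h : Level S m b T)
    (x : ℤ) {v : ℤ} {p : Prop} (hv : v = ind p) :
    Level S (write m (b + x) v) b fun z => z = x ∧ p ∨ z ≠ x ∧ T z := by
  intro z h₁ h₂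
  rw [write_apply, hv]
  split_ifs with hz
  · obtain rfl : z = x := by omega
    simp
  · have : z ≠ x := by omega
    rw [h z h₁ h₂]
    simp [this]

theorem Level.write_of_lt {S : ℤ} {m : ℤ → ℤ} {b a v : ℤ} {T : ℤ → Prop} (h : Level S m b T)
    (ha : a < b ∨ b + S ≤ a) : Level S (write m a v) b T := by
  intro z h₁ h₂
  rw [write_apply, if_neg (by omega), h z h₁ h₂]

/-- The heaps `m` and `m'` agree outside of the addresses from `lo` to `hi - 1`. -/
def Outside (lo hi : ℤ) (m m' : ℤ → ℤ) : Prop := ∀ a, a < lo ∨ hi ≤ a → m' a = m a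

theorem Outside.refl (lo hi : ℤ) (m : ℤ → ℤ) : Outside lo hi m m := fun _ _ => rfl

theorem Outside.write {lo hi : ℤ} {m m' : ℤ → ℤ} (h : Outside lo hi m m') {a : ℤ} (v : ℤ)
    (h₁ : lo ≤ a) (h₂ : a < hi) : Outside lo hi m (write m' a v) := fun c hc => by
  rw [write_apply, if_neg (by omega), h c hc]

/-- The values of the variables that the inner loops rely on. -/
structure Env (v : Global → ℤ) (S e W b : ℤ) : Prop where
  one : v one = 1
  zero : v zero = 0
  stride : v stride = S
  finish : v finish = e
  omega : v omega = W
  base : v base = b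
  finish_ge : 32 ≤ e
  finish_lt : e < S

def conjBody : Cmd :=
  op (load (t val) (t parent) (t node)) ;;
  ite (t val) skip (op (store (g base) (t node) (g zero))) ;;
  op (store (t parent) (t node) (g zero)) ;;
  op (addConst (t node) (t node) (-1)) ;;
  op (addConst (t count) (t node) (-31))

/-- Remove the top array, and put the conjunction of the two uppermost arrays in place of the
second. -/
def conjCmd : Cmd :=
  op (sub (g base) (g base) (g stride)) ;;
  op (add (t parent) (g base) (g stride)) ;;
  op (add (t node) (g finish) (g zero)) ;;
  op (addConst (t count) (t node) (-31)) ;;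
  loop (t count) conjBody

/-- The upper array is cleared while it is consumed. The heap above the stack thus stays zero, so
that every new array starts out as the empty set. -/
theorem conjCmd_spec {s : State} {S e W b : ℤ} (h : Env s.g S e W (b + S)) (hb : S ≤ b)
    {T U : ℤ → Prop} (hT : Level S s.mem (b + S) T) (hU : Level S s.mem b U)
    (hTe : ∀ z, T z → 32 ≤ z ∧ z ≤ e) (hUe : ∀ z, U z → 32 ≤ z ∧ z ≤ e)
    {Q : State → Prop}
    (hQ : ∀ s' : State, s'.g = Function.update s.g base b → s'.input = s.input →
      s'.output = s.output → Level S s'.mem b (fun z => T z ∧ U z) →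
      (∀ z, 0 ≤ z → z < S → s'.mem (b + S + z) = 0) →
      Outside b (b + S + S) s.mem s'.mem →
      s'.time ≤ s.time + 100 * S → Q s') : conjCmd.wp Q s := by
  obtain ⟨-, h2, h3, h4, -, h6, h7, h8⟩ := h
  simp only [conjCmd, wp_op, wp_seq, Op.Ok, Op.apply, State.set, State.tick, State.get,
    Function.update_apply, reduceCtorEq, if_true, if_false, true_and, h2, h3, h4, h6]
  -- Entries are processed downwards from `e` to 32. With `n` rounds left, the next entry is `n +
  -- 31` and the entries below `n + 32` are untouched.
  refine wp_loop (fun n s' => s'.g = Function.update s.g base b ∧ s'.input = s.input ∧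
    s'.output = s.output ∧ s'.t parent = b + S ∧ s'.t node = n + 31 ∧ s'.t count = n ∧
    n + 31 ≤ e ∧ s'.time + 20 * n ≤ s.time + 20 + 20 * S ∧
    (∀ z, 0 ≤ z → z < S → s'.mem (b + z) = if z < n + 32 then ind (U z) else ind (T z ∧ U z)) ∧
    (∀ z, 0 ≤ z → z < S → s'.mem (b + S + z) = if z < n + 32 then ind (T z) else 0) ∧
    Outside b (b + S + S) s.mem s'.mem) (e - 31).toNat ?_ ?_ ?_ ?_
  · simp [State.tick]
    have : max (e - 31) 0 = e - 31 := by omega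
    rw [this]
    refine ⟨by omega, by omega, by omega, by omega, ?_, ?_⟩
    · intro z h h'
      rw [hU z h h']
      split_ifs with h9
      · rfl
      · rw [ind_of_false, ind_of_false]
        · intro h; have := hUe z h.2; omega
        · intro h; have := hUe z h; omega
    · refine ⟨fun z h h' => ?_, Outside.refl _ _ _⟩
      rw [hT z h h']
      split_ifs with h9
      · rfl
      · rw [ind_of_false]
        intro h; have := hTe z h; omega
  · rintro n s' ⟨-, -, -, -, -, h, -⟩
    simp [h]
  · rintro n s' ⟨hg, hi, ho, hp, hn, hc, hle, ht, hB, hC, hF⟩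
    push_cast at *
    have hCn := hC (n + 1 + 31) (by omega) (by omega)
    have hBn := hB (n + 1 + 31) (by omega) (by omega)
    rw [if_pos (by omega)] at hCn hBn
    simp only [conjBody, skip, wp_op, wp_seq, wp_ite, Op.Ok, Op.apply, State.set,
      State.tick, State.get, write_apply, Function.update_apply, reduceCtorEq, if_true, if_false,
      true_and, hg, hp, hn, h2, hCn, ind_pos, ind_nonpos]
    refine ⟨by omega, fun hT' => ⟨by omega, hi, ho, by omega, by omega, by omega, by omega,
      ?_, ?_, ?_⟩, fun hT' => ⟨by omega, by omega, hi, ho, by omega, by omega, by omega, by omega, ?_, ?_, ?_⟩⟩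
    · intro z h h'
      have := hB z h h'
      grind [ind_congr, write_apply]
    · intro z h h'
      have := hC z h h'
      grind [write_apply]
    · exact hF.write _ (by omega) (by omega)
    · intro z h h'
      have := hB z h h'
      grind [ind_of_false, write_apply]
    · intro z h h'
      have := hC z h h'
      grind [write_apply]
    · exact (hF.write _ (by omega) (by omega)).write _ (by omega) (by omega)
  · rintro s' ⟨hg, hi, ho, hp, hn, hc, hle, ht, hB, hC, hF⟩
    refine hQ s' hg hi ho (fun z h h' => ?_) (fun z h h' => ?_) hF (by omega)
    · rw [hB z h h']
      split_ifs with h9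
      · rw [ind_of_false, ind_of_false]
        · intro h; have := hUe z h.2; omega
        · intro h; have := hUe z h; omega
      · rfl
    · rw [hC z h h']
      split_ifs with h9
      · rw [ind_of_false]
        intro h; have := hTe z h; omega
      · rfl

end Structured

/-! ### Comparison of codes, and recursions for truth along the tree. -/

namespace RCOmega

open Token

/-- The number that stands for a token in the heap: `ω` is represented by `W`. -/
def Token.value (W : ℤ) : Token → ℤ
  | modality none => W
  | t => t.code

/-- The finite modality in a token, if there is one, has a code below `W`. -/
def Token.Bounded (W : ℤ) (t : Token) : Prop :=
  7 ≤ W ∧ ∀ n : ℕ, t = modality (WithTop.some n) → 7 + (n : ℤ) < W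

theorem Token.value_top (W : ℤ) : (modality ⊤).value W = W := rfl

theorem Token.value_coe (W : ℤ) (n : ℕ) : (modality (WithTop.some n)).value W = 7 + n := rfl

theorem Token.exists_modality_iff {γ : Modality} {p : Modality → Prop} :
    (∃ δ, modality γ = modality δ ∧ p δ) ↔ p γ :=
  ⟨fun ⟨_, h, h'⟩ => Token.modality.inj h ▸ h', fun h => ⟨_, rfl, h⟩⟩

theorem Token.seven_le_value {W : ℤ} {α : Modality} (h : (modality α).Bounded W) :
    6 < (modality α).value W := by
  have := h.1
  induction α using WithTop.recTopCoe with
  | top => rw [value_top]; omega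
  | coe a => rw [value_coe]; omega

/-- Finite modalities have values from 7 to `W - 1`, `ω` has the value `W`, and all other symbols
lie below 7. One integer comparison therefore tests both that `t` is a modality and that it is large
enough. -/
theorem Token.value_le_iff {W : ℤ} {α : Modality} {t : Token} (h : (modality α).Bounded W)
    (ht : t.Bounded W) :
    (modality α).value W ≤ t.value W ↔ ∃ γ, t = modality γ ∧ α ≤ γ := by
  have h₆ := Token.seven_le_value h
  rcases t with _ | _ | _ | _ | _ | γ | p
  case modality =>
    rw [exists_modality_iff]
    induction γ using WithTop.recTopCoe with
    | top =>
      induction α using WithTop.recTopCoe with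
      | top => simp
      | coe a => have := h.2 a rfl; rw [value_top, value_coe]; simp; omega
    | coe c =>
      have := ht.2 c rfl
      induction α using WithTop.recTopCoe with
      | top => rw [value_top, value_coe]; simp; omega
      | coe a => rw [value_coe, value_coe, WithTop.coe_le_coe]; omega
  all_goals
    simp only [reduceCtorEq, false_and, exists_false, iff_false]
    simp only [value, code]
    simp only [value, code] at h₆
    omega

theorem Token.value_lt_iff {W : ℤ} {α : Modality} {t : Token} (h : (modality α).Bounded W)
    (ht : t.Bounded W) :
    (modality α).value W < t.value W ↔ ∃ γ, t = modality γ ∧ α < γ := by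
  have h₆ := Token.seven_le_value h
  rcases t with _ | _ | _ | _ | _ | γ | p
  case modality =>
    rw [exists_modality_iff, ← not_le, ← not_le, Token.value_le_iff ht h, exists_modality_iff]
  all_goals
    simp only [reduceCtorEq, false_and, exists_false, iff_false]
    simp only [value, code]
    simp only [value, code] at h₆
    omega

theorem Token.value_eq_letter_iff {W : ℤ} {t : Token} (ht : t.Bounded W) {p : ℕ} :
    t.value W = (letter p).value W ↔ t = letter p := by
  rcases t with _ | _ | _ | _ | _ | γ | q
  case modality =>
    have := Token.seven_le_value ht
    simp only [reduceCtorEq, iff_false]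
    have : (letter p).value W = -1 - p := rfl
    omega
  all_goals
    simp only [value, code, letter.injEq, reduceCtorEq, iff_false]
    omega

theorem Token.omega_le_value_iff {W : ℤ} {t : Token} (ht : t.Bounded W) :
    W ≤ t.value W ↔ t = modality ⊤ := by
  refine (Token.value_le_iff (α := ⊤) ⟨ht.1, fun n h => ?_⟩ ht).trans ?_
  · exact absurd (Token.modality.inj h) WithTop.top_ne_coe
  · simp only [top_le_iff, exists_eq_right]

namespace Arena

variable {M : Arena}

/-- Some child of `z` beyond `x` satisfies `E`. -/
def Seen (M : Arena) (E : ℤ → Prop) (x z : ℤ) : Prop := ∃ y, x < y ∧ M.par y = z ∧ E y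

/-- The recursion for a scan with descending `x`: processing `x` adds just the edge from `x` to its
parent. -/
theorem seen_sub_one {E : ℤ → Prop} {x z : ℤ} :
    M.Seen E (x - 1) z ↔ M.Seen E x z ∨ (M.par x = z ∧ E x) := by
  constructor
  · rintro ⟨y, h, h'⟩
    rcases (show x = y ∨ x < y by omega) with rfl | h
    · exact .inr h'
    · exact .inl ⟨y, h, h'⟩
  · rintro (⟨y, h, h'⟩ | h)
    · exact ⟨y, by omega, h'⟩
    · exact ⟨x, by omega, h⟩

theorem not_seen_last {E : ℤ → Prop} (hE : ∀ y, E y → y ≤ M.last) (z : ℤ) :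
    ¬M.Seen E M.last z := by
  rintro ⟨y, h, -, h'⟩
  have := hE y h'
  omega

/-- Since children have larger addresses than parents, the entry of a node is final once a
descending scan reaches the node. -/
theorem seen_iff {E : ℤ → Prop} (hE : ∀ y, E y → M.par y < y) {x z : ℤ} (h : x ≤ z) :
    M.Seen E x z ↔ ∃ y, M.par y = z ∧ E y :=
  ⟨fun ⟨y, _, h'⟩ => ⟨y, h'⟩, fun ⟨y, h', h''⟩ => ⟨y, by have := hE y h''; omega, h', h''⟩⟩

theorem seen_root_iff {E : ℤ → Prop} (hE : ∀ y, E y → 32 ≤ M.par y ∧ M.par y < y) {z : ℤ} :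
    M.Seen E 32 z ↔ ∃ y, M.par y = z ∧ E y :=
  ⟨fun ⟨y, _, h'⟩ => ⟨y, h'⟩, fun ⟨y, h', h''⟩ => ⟨y, by have := hE y h''; omega, h', h''⟩⟩

/-- The edge to `y` makes the variable `p` true at the parent of `y`. -/
def VarEdge (M : Arena) (p : ℕ) (y : ℤ) : Prop :=
  M.lab y = letter p ∨ M.lab y = modality ⊤ ∧ M.Var p y

theorem VarEdge.range {p : ℕ} {y : ℤ} (h : M.VarEdge p y) :
    32 ≤ M.par y ∧ M.par y < y ∧ y ≤ M.last := by
  rcases h with h | h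
  · exact M.letter_range _ _ h
  · exact M.modality_range _ _ h.1

theorem var_iff {p : ℕ} {z : ℤ} : M.Var p z ↔ ∃ y, M.par y = z ∧ M.VarEdge p y := by
  constructor
  · rintro (h | ⟨h, h'⟩)
    · exact ⟨_, rfl, .inl h⟩
    · exact ⟨_, rfl, .inr ⟨h, h'⟩⟩
  · rintro ⟨y, rfl, h | h⟩
    · exact .own h
    · exact .persist h.1 h.2

/-- The nodes below which `T` holds, along edges of modalities at least `α`. -/
inductive Down (M : Arena) (α : Modality) (T : ℤ → Prop) : ℤ → Prop
  | child {y : ℤ} {γ : Modality} : M.lab y = modality γ → α ≤ γ → T y → Down M α T (M.par y)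
  | desc {y : ℤ} {γ : Modality} :
      M.lab y = modality γ → α ≤ γ → Down M α T y → Down M α T (M.par y)

/-- The edge to `y` makes `Down` true at the parent of `y`. -/
def DownEdge (M : Arena) (α : Modality) (T : ℤ → Prop) (y : ℤ) : Prop :=
  (∃ γ, M.lab y = modality γ ∧ α ≤ γ) ∧ (T y ∨ M.Down α T y)

theorem DownEdge.range {α : Modality} {T : ℤ → Prop} {y : ℤ} (h : M.DownEdge α T y) :
    32 ≤ M.par y ∧ M.par y < y ∧ y ≤ M.last := by
  obtain ⟨⟨γ, h, -⟩, -⟩ := h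
  exact M.modality_range _ _ h

theorem down_iff {α : Modality} {T : ℤ → Prop} {z : ℤ} :
    M.Down α T z ↔ ∃ y, M.par y = z ∧ M.DownEdge α T y := by
  constructor
  · rintro (⟨h, h', h''⟩ | ⟨h, h', h''⟩)
    · exact ⟨_, rfl, ⟨_, h, h'⟩, .inl h''⟩
    · exact ⟨_, rfl, ⟨_, h, h'⟩, .inr h''⟩
  · rintro ⟨y, rfl, ⟨γ, h, h'⟩, h'' | h''⟩
    · exact .child h h' h''
    · exact .desc h h' h''

theorem Down.range {α : Modality} {T : ℤ → Prop} {z : ℤ} (h : M.Down α T z) :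
    32 ≤ z ∧ z ≤ M.last := by
  obtain ⟨y, rfl, hy⟩ := down_iff.1 h
  have := hy.range
  omega

/-- Reach a node of `Down` by moves to the parent. -/
inductive Reach (M : Arena) (α : Modality) (T : ℤ → Prop) : ℤ → Prop
  | down {y : ℤ} : M.Down α T y → Reach M α T y
  | up {y : ℤ} {γ : Modality} :
      M.lab y = modality γ → α < γ → Reach M α T (M.par y) → Reach M α T y

/-- Normal form of paths: going down an edge and immediately up the same edge is a detour. So a step
`desc` onto a path that begins with `up` cancels, and all upward moves can come first. -/
theorem dia_iff_reach {α : Modality} {T : ℤ → Prop} {z : ℤ} :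
    M.Dia α T z ↔ M.Reach α T z := by
  constructor
  · intro h
    induction h with
    | child h h' h'' => exact .down (.child h h' h'')
    | desc h h' _ ih =>
      cases ih with
      | down ih => exact .down (.desc h h' ih)
      | up _ _ ih => exact ih
    | up h h' _ ih => exact .up h h' ih
  · intro h
    induction h with
    | down h =>
      induction h with
      | child h h' h'' => exact .child h h' h''
      | desc h h' _ ih => exact .desc h h' ih
    | up h h' _ ih => exact .up h h' ih

/-- The recursion for the second scan, with ascending addresses: the value at the parent is already
known. -/
theorem dia_iff {α : Modality} {T : ℤ → Prop} {z : ℤ} :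
    M.Dia α T z ↔ M.Down α T z ∨ (∃ γ, M.lab z = modality γ ∧ α < γ) ∧ M.Dia α T (M.par z) := by
  simp only [dia_iff_reach]
  constructor
  · rintro (h | ⟨h, h', h''⟩)
    · exact .inl h
    · exact .inr ⟨⟨_, h, h'⟩, h''⟩
  · rintro (h | ⟨⟨_, h, h'⟩, h''⟩)
    · exact .down h
    · exact .up h h' h''

end Arena

end RCOmega

/-! ### Arrays for `⊤` and for variables. -/

namespace Structured

open RCOmega Op Cmd Global Temp Var

/-- The heap contains the tree `M`: tokens from `32` on, and parents `S` places further. -/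
structure Heap (M : Arena) (S W : ℤ) (m : ℤ → ℤ) : Prop where
  lab : ∀ y, 32 ≤ y → y ≤ M.last → m y = (M.lab y).value W
  par : ∀ y, 33 ≤ y → y ≤ M.last → m (y + S) = M.par y
  bounded : ∀ y, (M.lab y).Bounded W

def topBody : Cmd :=
  op (store (g base) (t node) (g one)) ;;
  op (addConst (t node) (t node) (-1)) ;;
  op (addConst (t count) (t node) (-31))

/-- Add an array for the formula `⊤`. -/
def topCmd : Cmd :=
  op (add (g base) (g base) (g stride)) ;;
  op (add (t node) (g finish) (g zero)) ;;
  op (addConst (t count) (t node) (-31)) ;;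
  loop (t count) topBody

theorem topCmd_spec {s : State} {S e W b : ℤ} (h : Env s.g S e W b) (hb : 0 ≤ b)
    (hC : ∀ z, 0 ≤ z → z < S → s.mem (b + S + z) = 0)
    {Q : State → Prop}
    (hQ : ∀ s' : State, s'.g = Function.update s.g base (b + S) → s'.input = s.input →
      s'.output = s.output → Level S s'.mem (b + S) (fun z => 32 ≤ z ∧ z ≤ e) →
      Outside (b + S) (b + S + S) s.mem s'.mem →
      s'.time ≤ s.time + 100 * S → Q s') : topCmd.wp Q s := by
  obtain ⟨h1, h2, h3, h4, -, h6, h7, h8⟩ := h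
  simp only [topCmd, wp_op, wp_seq, Op.Ok, Op.apply, State.set, State.tick, State.get,
    Function.update_apply, reduceCtorEq, if_true, if_false, true_and, h2, h3, h4, h6]
  refine wp_loop (fun n s' => s'.g = Function.update s.g base (b + S) ∧ s'.input = s.input ∧
    s'.output = s.output ∧ s'.t node = n + 31 ∧ s'.t count = n ∧
    n + 31 ≤ e ∧ s'.time + 20 * n ≤ s.time + 20 + 20 * S ∧
    Level S s'.mem (b + S) (fun z => n + 31 < z ∧ z ≤ e) ∧
    Outside (b + S) (b + S + S) s.mem s'.mem) (e - 31).toNat ?_ ?_ ?_ ?_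
  · simp [State.tick]
    have : max (e - 31) 0 = e - 31 := by omega
    rw [this]
    refine ⟨by omega, by omega, by omega, by omega, ?_, Outside.refl _ _ _⟩
    intro z h h'
    rw [hC z h h', ind_of_false (by omega)]
  · rintro n s' ⟨-, -, -, -, h, -⟩
    simp [h]
  · rintro n s' ⟨hg, hi, ho, hn, hc, hle, ht, hB, hF⟩
    push_cast at *
    simp only [topBody, wp_op, wp_seq, Op.Ok, Op.apply, State.set, State.tick,
      State.get, Function.update_apply, reduceCtorEq, if_true, if_false, true_and, hg, hn, h1]
    exact ⟨by omega, hi, ho, by omega, by omega, by omega, by omega,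
      (hB.write_one _).congr fun z => by omega, hF.write _ (by omega) (by omega)⟩
  · rintro s' ⟨hg, hi, ho, hn, hc, hle, ht, hB, hF⟩
    exact hQ s' hg hi ho (hB.congr fun z => by push_cast; omega) hF (by omega)

/-- Equality of two codes is tested by two strict comparisons that both fail. -/
def ownBody : Cmd :=
  op (load (t sym) (t node) (g zero)) ;;
  op (load (t parent) (t node) (g stride)) ;;
  op (sub (t scratch) (t sym) (g code)) ;;
  ite (t scratch) skip
    (op (sub (t scratch) (g code) (t sym)) ;;
     ite (t scratch) skip (op (store (g base) (t parent) (g one))))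

def persistBody : Cmd :=
  op (sub (t scratch) (t sym) (g omega)) ;;
  op (addConst (t scratch) (t scratch) 1) ;;
  ite (t scratch)
    (op (load (t val) (g base) (t node)) ;;
     ite (t val) (op (store (g base) (t parent) (g one))) skip)
    skip ;;
  op (addConst (t node) (t node) (-1)) ;;
  op (addConst (t count) (t node) (-32))

/-- Add an array for the variable whose code is in `code`. -/
def letterCmd : Cmd :=
  op (add (g base) (g base) (g stride)) ;;
  op (add (t node) (g finish) (g zero)) ;;
  op (addConst (t count) (t node) (-32)) ;;
  loop (t count) (ownBody ;; persistBody)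

/-- Addresses are scanned downwards, and each edge pushes its contribution to the parent: by a
letter `p`, or along `ω` from a child whose own entry is final by then. -/
theorem letterCmd_spec {M : Arena} {s : State} {S W b : ℤ} (h : Env s.g S M.last W b)
    (hb : S ≤ b) (hM : Heap M S W s.mem) {p : ℕ}
    (hp : s.g code = (Token.letter p).value W)
    (hC : ∀ z, 0 ≤ z → z < S → s.mem (b + S + z) = 0)
    {Q : State → Prop}
    (hQ : ∀ s' : State, s'.g = Function.update s.g base (b + S) → s'.input = s.input →
      s'.output = s.output → Level S s'.mem (b + S) (M.Holds (.var p)) →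
      Outside (b + S) (b + S + S) s.mem s'.mem →
      s'.time ≤ s.time + 100 * S → Q s') : letterCmd.wp Q s := by
  obtain ⟨h1, h2, h3, h4, h5, h6, h7, h8⟩ := h
  simp only [letterCmd, wp_op, wp_seq, Op.Ok, Op.apply, State.set, State.tick, State.get,
    Function.update_apply, reduceCtorEq, if_true, if_false, true_and, h2, h3, h4, h6]
  refine wp_loop (fun n s' => s'.g = Function.update s.g base (b + S) ∧ s'.input = s.input ∧
    s'.output = s.output ∧ s'.t node = n + 32 ∧ s'.t count = n ∧
    n + 32 ≤ M.last ∧ s'.time + 50 * n ≤ s.time + 20 + 50 * S ∧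
    Level S s'.mem (b + S) (M.Seen (M.VarEdge p) (n + 32)) ∧
    Outside (b + S) (b + S + S) s.mem s'.mem) (M.last - 32).toNat ?_ ?_ ?_ ?_
  · simp [State.tick]
    have : max (M.last - 32) 0 = M.last - 32 := by omega
    rw [this]
    refine ⟨by omega, by omega, by omega, by omega, ?_, Outside.refl _ _ _⟩
    intro z h h'
    rw [hC z h h', ind_of_false]
    rw [sub_add_cancel]
    exact Arena.not_seen_last (fun y hy => hy.range.2.2) z
  · rintro n s' ⟨-, -, -, -, h, -⟩
    simp [h]
  · rintro n s' ⟨hg, hi, ho, hn, hc, hle, ht, hB, hF⟩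
    obtain ⟨x, hx⟩ : ∃ x : ℤ, x = n + 33 := ⟨_, rfl⟩
    rw [show ((n + 1 : ℕ) : ℤ) + 32 = x by push_cast; omega] at *
    rw [show (n : ℤ) + 32 = x - 1 by omega]
    have hl : s'.mem x = (M.lab x).value W := by
      rw [hF _ (by omega), hM.lab _ (by omega) (by omega)]
    have hpar : s'.mem (x + S) = M.par x := by
      rw [hF _ (by omega), hM.par _ (by omega) (by omega)]
    -- The intermediate assertion records the contribution of the letter at `x`; that of an `ω`-edge
    -- is added by the second half of the body.
    refine wp_seq_of (fun s₁ => s₁.g = Function.update s.g base (b + S) ∧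
      s₁.input = s.input ∧ s₁.output = s.output ∧ s₁.t node = x ∧
      s₁.t sym = (M.lab x).value W ∧ s₁.t parent = M.par x ∧ s₁.time ≤ s'.time + 25 ∧
      Level S s₁.mem (b + S) (fun z => M.Seen (M.VarEdge p) x z ∨
        M.par x = z ∧ M.lab x = .letter p) ∧
      Outside (b + S) (b + S + S) s.mem s₁.mem) ?_ ?_
    · have heq := Token.value_eq_letter_iff (hM.bounded x) (p := p)
      have hrange := M.letter_range x p
      simp only [ownBody, skip, wp_op, wp_seq, wp_ite, Op.Ok, Op.apply, State.set, State.tick,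
        State.get, Function.update_apply, reduceCtorEq, if_true, if_false, true_and, hg, hn, h1,
        h2, h3, hp, add_zero, hl, hpar, hi, ho]
      refine ⟨by omega, by omega, fun h => ⟨by omega, hB.congr fun z => ?_, hF⟩,
        fun h => ⟨fun h' => ⟨by omega, hB.congr fun z => ?_, hF⟩, fun h' => ?_⟩⟩
      · have : M.lab x ≠ .letter p := fun h => by have := heq.2 h; omega
        simp [this]
      · have : M.lab x ≠ .letter p := fun h => by have := heq.2 h; omega
        simp [this]
      · have := heq.1 (by omega)
        have hr := hrange this
        refine ⟨by omega, by omega, (hB.write_one _).congr fun z => ?_,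
          hF.write _ (by omega) (by omega)⟩
        simp [this]
    · rintro s₁ ⟨hg, hi, ho, hn, hs, hp', ht', hB, hF⟩
      -- The contribution just made cannot concern `x` itself, since a parent is smaller than its
      -- child.
      have hval : s₁.mem (b + S + x) = ind (M.Var p x) := by
        rw [hB _ (by omega) (by omega)]
        refine ind_congr ⟨fun h => ?_, fun h => .inl ?_⟩
        · rcases h with h | ⟨h, h'⟩
          · exact Arena.var_iff.2 ((Arena.seen_iff (fun y hy => hy.range.2.1) le_rfl).1 h)
          · have := M.letter_range _ _ h'; omega
        · exact (Arena.seen_iff (fun y hy => hy.range.2.1) le_rfl).2 (Arena.var_iff.1 h)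
      have hle' := Token.omega_le_value_iff (hM.bounded x)
      have hrange := M.modality_range x ⊤
      have hstep : ∀ z, M.Seen (M.VarEdge p) (x - 1) z ↔ (M.Seen (M.VarEdge p) x z ∨
          M.par x = z ∧ M.lab x = .letter p) ∨
          M.par x = z ∧ M.lab x = .modality ⊤ ∧ M.Var p x := by
        intro z
        rw [Arena.seen_sub_one, Arena.VarEdge]
        tauto
      simp only [persistBody, skip, wp_op, wp_seq, wp_ite, Op.Ok, Op.apply, State.set,
        State.tick, State.get, Function.update_apply, reduceCtorEq, if_true, if_false, true_and,
        hg, hn, h1, h5, hs, hp', hi, ho, hval, ind_pos, ind_nonpos]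
      refine ⟨fun h => ⟨by omega, fun h' => ⟨?_, ?_⟩, fun h' => ?_⟩, fun h => ?_⟩
      · have := hrange (hle'.1 (by omega))
        omega
      · have hlab := hle'.1 (by omega)
        have := hrange hlab
        refine ⟨by omega, by omega, by omega, by omega, (hB.write_one _).congr fun z => ?_,
          hF.write _ (by omega) (by omega)⟩
        rw [hstep]
        simp [hlab, h']
      · refine ⟨by omega, by omega, by omega, by omega, hB.congr fun z => ?_, hF⟩
        rw [hstep]
        simp [h']
      · have : M.lab x ≠ .modality ⊤ := fun h => by have := hle'.2 h; omega
        refine ⟨by omega, by omega, by omega, by omega, hB.congr fun z => ?_, hF⟩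
        rw [hstep]
        simp [this]
  · rintro s' ⟨hg, hi, ho, hn, hc, hle, ht, hB, hF⟩
    refine hQ s' hg hi ho (hB.congr fun z => ?_) hF (by omega)
    rw [Nat.cast_zero, zero_add, Arena.seen_root_iff fun y hy => ⟨hy.range.1, hy.range.2.1⟩]
    exact Arena.var_iff.symm

end Structured

/-! ### Arrays for modal formulas: the scans downwards and upwards in address. -/

namespace Structured

open RCOmega Op Cmd Global Temp Var

def downBody : Cmd :=
  op (load (t sym) (t node) (g zero)) ;;
  op (sub (t scratch) (t sym) (g code)) ;;
  op (addConst (t scratch) (t scratch) 1) ;;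
  ite (t scratch)
    (op (load (t parent) (t node) (g stride)) ;;
     op (load (t val) (g base) (t node)) ;;
     ite (t val) (op (store (t aux) (t parent) (g one)))
      (op (load (t val) (t aux) (t node)) ;;
       ite (t val) (op (store (t aux) (t parent) (g one))) skip))
    skip ;;
  op (addConst (t node) (t node) (-1)) ;;
  op (addConst (t count) (t node) (-32))

def downCmd : Cmd :=
  op (add (t aux) (g base) (g stride)) ;;
  op (add (t node) (g finish) (g zero)) ;;
  op (addConst (t count) (t node) (-32)) ;;
  loop (t count) downBody

def upBody : Cmd :=
  op (load (t val) (t aux) (t node)) ;;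
  op (load (t sym) (t node) (g zero)) ;;
  op (sub (t scratch) (t sym) (g code)) ;;
  ite (t scratch)
    (op (load (t parent) (t node) (g stride)) ;;
     op (load (t scratch) (g base) (t parent)) ;;
     ite (t scratch) (op (const (t val) 1)) skip)
    skip ;;
  op (store (g base) (t node) (t val)) ;;
  op (store (t aux) (t node) (g zero)) ;;
  op (addConst (t node) (t node) 1) ;;
  op (sub (t count) (g finish) (t node)) ;;
  op (addConst (t count) (t count) 1)

def upCmd : Cmd :=
  op (const (t node) 32) ;;
  op (sub (t count) (g finish) (t node)) ;;
  op (addConst (t count) (t count) 1) ;;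
  loop (t count) upBody

/-- `Down` is collected in the zero array above the top, because `T` is still needed: an edge
contributes if `T` or `Down` holds at the child. -/
theorem downCmd_spec {M : Arena} {s : State} {S W b : ℤ} (h : Env s.g S M.last W b)
    (hb : 2 * S ≤ b) (hM : Heap M S W s.mem) {α : Modality}
    (hα : (Token.modality α).Bounded W) (hc : s.g code = (Token.modality α).value W)
    {T : ℤ → Prop} (hT : Level S s.mem b T)
    (hC : ∀ z, 0 ≤ z → z < S → s.mem (b + S + z) = 0)
    {Q : State → Prop}
    (hQ : ∀ s' : State, s'.g = s.g → s'.input = s.input → s'.output = s.output →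
      s'.t aux = b + S → Level S s'.mem (b + S) (M.Down α T) →
      Outside (b + S) (b + S + S) s.mem s'.mem →
      s'.time ≤ s.time + 100 * S → Q s') : downCmd.wp Q s := by
  obtain ⟨h1, h2, h3, h4, -, h6, h7, h8⟩ := h
  simp only [downCmd, wp_op, wp_seq, Op.Ok, Op.apply, State.set, State.tick, State.get,
    Function.update_apply, reduceCtorEq, if_true, if_false, true_and, h2, h3, h4, h6]
  refine wp_loop (fun n s' => s'.g = s.g ∧ s'.input = s.input ∧
    s'.output = s.output ∧ s'.t aux = b + S ∧ s'.t node = n + 32 ∧ s'.t count = n ∧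
    n + 32 ≤ M.last ∧ s'.time + 50 * n ≤ s.time + 20 + 50 * S ∧
    Level S s'.mem (b + S) (M.Seen (M.DownEdge α T) (n + 32)) ∧
    Outside (b + S) (b + S + S) s.mem s'.mem) (M.last - 32).toNat ?_ ?_ ?_ ?_
  · simp [State.tick]
    have : max (M.last - 32) 0 = M.last - 32 := by omega
    rw [this]
    refine ⟨by omega, by omega, by omega, by omega, ?_, Outside.refl _ _ _⟩
    intro z h h'
    rw [hC z h h', ind_of_false]
    rw [sub_add_cancel]
    exact Arena.not_seen_last (fun y hy => hy.range.2.2) z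
  · rintro n s' ⟨-, -, -, -, -, h, -⟩
    simp [h]
  · rintro n s' ⟨hg, hi, ho, ha, hn, hc', hle, ht, hB, hF⟩
    obtain ⟨x, hx⟩ : ∃ x : ℤ, x = n + 33 := ⟨_, rfl⟩
    rw [show ((n + 1 : ℕ) : ℤ) + 32 = x by push_cast; omega] at *
    rw [show (n : ℤ) + 32 = x - 1 by omega]
    have hl : s'.mem x = (M.lab x).value W := by
      rw [hF _ (by omega), hM.lab _ (by omega) (by omega)]
    have hpar : s'.mem (x + S) = M.par x := by
      rw [hF _ (by omega), hM.par _ (by omega) (by omega)]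
    have hTx : s'.mem (b + x) = ind (T x) := by
      rw [hF _ (by omega), hT _ (by omega) (by omega)]
    have hval : s'.mem (b + S + x) = ind (M.Down α T x) := by
      rw [hB _ (by omega) (by omega)]
      exact ind_congr ((Arena.seen_iff (fun y hy => hy.range.2.1) le_rfl).trans
        Arena.down_iff.symm)
    have hle' := Token.value_le_iff hα (hM.bounded x)
    have hrange : (∃ γ, M.lab x = .modality γ ∧ α ≤ γ) → 32 ≤ M.par x ∧ M.par x < x :=
      fun ⟨γ, h, _⟩ => ⟨(M.modality_range x γ h).1, (M.modality_range x γ h).2.1⟩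
    simp only [downBody, skip, wp_op, wp_seq, wp_ite, Op.Ok, Op.apply, State.set,
      State.tick, State.get, Function.update_apply, reduceCtorEq, if_true, if_false, true_and,
      hg, hn, h1, h2, h3, h6, ha, hc, hi, ho, hval, hTx, hl, hpar, add_zero, ind_pos, ind_nonpos]
    refine ⟨by omega, fun h => ⟨by omega, by omega, fun h' => ⟨?_, ?_⟩, fun h' => ⟨by omega,
      fun h'' => ⟨?_, ?_⟩, fun h'' => ?_⟩⟩, fun h => ?_⟩
    · have := hrange (hle'.1 (by omega))
      omega
    · have hlab := hle'.1 (by omega)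
      have := hrange hlab
      refine ⟨by omega, by omega, by omega, by omega, (hB.write_one _).congr fun z => ?_,
        hF.write _ (by omega) (by omega)⟩
      have : M.DownEdge α T x := ⟨hlab, .inl h'⟩
      simp [this, Arena.seen_sub_one]
    · have := hrange (hle'.1 (by omega))
      omega
    · have hlab := hle'.1 (by omega)
      have := hrange hlab
      refine ⟨by omega, by omega, by omega, by omega, (hB.write_one _).congr fun z => ?_,
        hF.write _ (by omega) (by omega)⟩
      have : M.DownEdge α T x := ⟨hlab, .inr h''⟩
      simp [this, Arena.seen_sub_one]
    · refine ⟨by omega, by omega, by omega, by omega, hB.congr fun z => ?_, hF⟩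
      have : ¬M.DownEdge α T x := fun h => h.2.elim h' h''
      simp [this, Arena.seen_sub_one]
    · refine ⟨by omega, by omega, by omega, by omega, hB.congr fun z => ?_, hF⟩
      have : ¬M.DownEdge α T x := fun h' => by have := hle'.2 h'.1; omega
      simp [this, Arena.seen_sub_one]
  · rintro s' ⟨hg, hi, ho, ha, hn, hc, hle, ht, hB, hF⟩
    refine hQ s' hg hi ho ha (hB.congr fun z => ?_) hF (by omega)
    rw [Nat.cast_zero, zero_add, Arena.seen_root_iff fun y hy => ⟨hy.range.1, hy.range.2.1⟩]
    exact Arena.down_iff.symm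

/-- The array of `T` can be overwritten in place: `T` enters the diamond only through `Down`, and
`dia_iff` needs beyond that only the new entry of the parent. The auxiliary array is cleared on the
way. -/
theorem upCmd_spec {M : Arena} {s : State} {S W b : ℤ} (h : Env s.g S M.last W b)
    (hb : 2 * S ≤ b) (hM : Heap M S W s.mem) {α : Modality}
    (hα : (Token.modality α).Bounded W) (hc : s.g code = (Token.modality α).value W)
    {T : ℤ → Prop} (hT : Level S s.mem b T) (hTe : ∀ z, T z → 32 ≤ z ∧ z ≤ M.last)
    (hD : Level S s.mem (b + S) (M.Down α T)) (ha : s.t aux = b + S)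
    {Q : State → Prop}
    (hQ : ∀ s' : State, s'.g = s.g → s'.input = s.input → s'.output = s.output →
      Level S s'.mem b (M.Dia α T) → (∀ z, 0 ≤ z → z < S → s'.mem (b + S + z) = 0) →
      Outside b (b + S + S) s.mem s'.mem →
      s'.time ≤ s.time + 100 * S → Q s') : upCmd.wp Q s := by
  obtain ⟨h1, h2, h3, h4, -, h6, h7, h8⟩ := h
  simp only [upCmd, wp_op, wp_seq, Op.Ok, Op.apply, State.set, State.tick, State.get,
    Function.update_apply, reduceCtorEq, if_true, if_false, true_and, h4]
  refine wp_loop (fun n s' => s'.g = s.g ∧ s'.input = s.input ∧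
    s'.output = s.output ∧ s'.t aux = b + S ∧ s'.t count = n ∧ ∃ x, s'.t node = x ∧
    x + n = M.last + 1 ∧ 32 ≤ x ∧ s'.time + 50 * n ≤ s.time + 20 + 50 * S ∧
    Level S s'.mem b (fun z => z < x ∧ M.Dia α T z ∨ x ≤ z ∧ T z) ∧
    Level S s'.mem (b + S) (fun z => x ≤ z ∧ M.Down α T z) ∧
    Outside b (b + S + S) s.mem s'.mem) (M.last - 31).toNat ?_ ?_ ?_ ?_
  · simp [State.tick, ha]
    have : max (M.last - 31) 0 = M.last - 31 := by omega
    rw [this]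
    refine ⟨by omega, by omega, by omega, hT.congr fun z => ?_, hD.congr fun z => ?_,
      Outside.refl _ _ _⟩
    · refine ⟨fun h => .inr ⟨(hTe z h).1, h⟩, fun h => h.elim (fun h => ?_) And.right⟩
      have := h.2.range
      omega
    · exact ⟨fun h => ⟨h.range.1, h⟩, And.right⟩
  · rintro n s' ⟨-, -, -, -, h, -⟩
    simp [h]
  · rintro n s' ⟨hg, hi, ho, ha, hc', x, hn, hx, hx', ht, hB, hD, hF⟩
    push_cast at hx ht
    have hl : s'.mem x = (M.lab x).value W := by
      rw [hF _ (by omega), hM.lab _ (by omega) (by omega)]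
    have hpar : (∃ γ, M.lab x = .modality γ ∧ α < γ) → s'.mem (x + S) = M.par x ∧
        32 ≤ M.par x ∧ M.par x < x ∧ s'.mem (b + M.par x) = ind (M.Dia α T (M.par x)) := by
      rintro ⟨γ, h, -⟩
      have := M.modality_range _ _ h
      rw [hF _ (by omega), hM.par _ (by omega) (by omega), hB _ (by omega) (by omega)]
      exact ⟨rfl, this.1, this.2.1, ind_congr (by simp [this])⟩
    have hval : s'.mem (b + S + x) = ind (M.Down α T x) := by
      rw [hD _ (by omega) (by omega)]
      exact ind_congr (by simp)
    have hlt := Token.value_lt_iff hα (hM.bounded x)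
    have hdia := Arena.dia_iff (M := M) (α := α) (T := T) (z := x)
    -- The branches of the body differ only in how they obtain the new entry `v`; the invariant is
    -- restored once for all of them.
    have hstep : ∀ v : ℤ, v = ind (M.Dia α T x) →
        Level S (write (write s'.mem (b + x) v) (b + S + x) 0) b
          (fun z => z < x + 1 ∧ M.Dia α T z ∨ x + 1 ≤ z ∧ T z) ∧
        Level S (write (write s'.mem (b + x) v) (b + S + x) 0) (b + S)
          (fun z => x + 1 ≤ z ∧ M.Down α T z) ∧
        Outside b (b + S + S) s.mem (write (write s'.mem (b + x) v) (b + S + x) 0) := by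
      intro v hv
      refine ⟨((hB.write_ind x hv).congr fun z => ?_).write_of_lt (by omega),
        ((hD.write_of_lt (by omega)).write_ind x (p := False) (by simp [ind])).congr
          fun z => ?_,
        (hF.write _ (by omega) (by omega)).write _ (by omega) (by omega)⟩
      · rcases lt_trichotomy z x with h | rfl | h
        · have h₁ : z ≠ x := h.ne
          have h₂ : z < x + 1 := by omega
          have h₃ : ¬ x + 1 ≤ z := by omega
          have h₄ : ¬ x ≤ z := by omega
          simp [h, h₁, h₂, h₃, h₄]
        · simp
        · have h₁ : z ≠ x := h.ne'
          have h₂ : ¬ z < x + 1 := by omega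
          have h₃ : x + 1 ≤ z := by omega
          have h₄ : ¬ z < x := by omega
          have h₅ : x ≤ z := by omega
          simp [h₁, h₂, h₃, h₄, h₅]
      · simp only [and_false, false_or, ← and_assoc]
        refine and_congr_left fun _ => ?_
        omega
    by_cases hlab : ∃ γ, M.lab x = .modality γ ∧ α < γ
    · obtain ⟨hp₁, hp₂, hp₃, hp₄⟩ := hpar hlab
      have := hlt.2 hlab
      simp only [upBody, skip, wp_op, wp_seq, wp_ite, Op.Ok, Op.apply, State.set,
        State.tick, State.get, Function.update_apply, reduceCtorEq, if_true, if_false, true_and,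
        hg, hn, h2, h3, h4, h6, ha, hc, hi, ho, hval, hl, hp₁, hp₄, add_zero, ind_pos, ind_nonpos]
      refine ⟨by omega, by omega, fun h => ⟨by omega, by omega, fun h' => ?_, fun h' => ?_⟩,
        fun h => by omega⟩
      · refine ⟨by omega, by omega, by omega, _, rfl, by omega, by omega, by omega,
          hstep _ (ind_of_true (hdia.2 (.inr ⟨hlab, h'⟩))).symm⟩
      · refine ⟨by omega, by omega, by omega, _, rfl, by omega, by omega, by omega,
          hstep _ (ind_congr ?_)⟩
        rw [hdia]
        simp [h']
    · have : ¬ (Token.modality α).value W < (M.lab x).value W := fun h => hlab (hlt.1 h)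
      simp only [upBody, skip, wp_op, wp_seq, wp_ite, Op.Ok, Op.apply, State.set,
        State.tick, State.get, Function.update_apply, reduceCtorEq, if_true, if_false, true_and,
        hg, hn, h2, h3, h4, h6, ha, hc, hi, ho, hval, hl, add_zero]
      refine ⟨by omega, by omega, fun h => by omega, fun h => ?_⟩
      refine ⟨by omega, by omega, by omega, _, rfl, by omega, by omega, by omega,
          hstep _ (ind_congr ?_)⟩
      rw [hdia]
      simp [hlab]
  · rintro s' ⟨hg, hi, ho, ha, hc, x, hn, hx, hx', ht, hB, hD, hF⟩
    push_cast at hx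
    refine hQ s' hg hi ho (hB.congr fun z => ?_) (fun z h h' => ?_) hF (by omega)
    · refine ⟨fun h => h.elim And.right fun h => ?_, fun h => .inl ⟨?_, h⟩⟩
      · have := hTe z h.2; omega
      · have := h.range; omega
    · rw [hD z h h', ind_of_false]
      rintro ⟨h₁, h₂⟩
      have := h₂.range
      omega

end Structured

/-! ### Evaluation of the right formula with a stack. -/

namespace RCOmega

open Token

/-- One step of the evaluation of a formula that is read from right to left. -/
def evalStep : Token → List Formula → Option (List Formula)
  | letter p, stk => some (.var p :: stk)
  | verum, stk => some (.top :: stk)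
  | modality α, A :: stk => some (.dia α A :: stk)
  | lparen, A :: B :: stk => some (.conj A B :: stk)
  | rparen, stk => some stk
  | wedge, stk => some stk
  | _, _ => none

def evalTokens : List Token → Option (List Formula)
  | [] => some []
  | t :: ts => (evalTokens ts).bind (evalStep t)

/-- Read from the right, the notation is postfix: a conjunction is formed at its opening
parenthesis, when both conjuncts lie on the stack with the left one on top. The other two symbols of
a conjunction have no effect. -/
theorem evalTokens_append (A : Formula) : ∀ {ts : List Token} {stk : List Formula},
    evalTokens ts = some stk → evalTokens (A.tokens ++ ts) = some (A :: stk) := by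
  induction A with
  | var p => intro ts stk h; simp [Formula.tokens, evalTokens, h, evalStep]
  | top => intro ts stk h; simp [Formula.tokens, evalTokens, h, evalStep]
  | conj A B ihA ihB =>
    intro ts stk h
    have h₁ : evalTokens (rparen :: ts) = some stk := by simp [evalTokens, h, evalStep]
    have h₂ : evalTokens (wedge :: (B.tokens ++ rparen :: ts)) = some (B :: stk) := by
      simp [evalTokens, ihB h₁, evalStep]
    simp [Formula.tokens, evalTokens, ihA h₂, evalStep]
  | dia α A ih =>
    intro ts stk h
    simp [Formula.tokens, evalTokens, ih h, evalStep]

/-- Guarantees that the stack never underflows at an intermediate stage of the evaluation. -/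
theorem exists_evalTokens_of_append {l₁ l₂ : List Token} {stk : List Formula}
    (h : evalTokens (l₁ ++ l₂) = some stk) : ∃ stk', evalTokens l₂ = some stk' := by
  induction l₁ generalizing stk with
  | nil => exact ⟨stk, h⟩
  | cons t ts ih =>
    obtain ⟨stk', h', -⟩ := Option.bind_eq_some_iff.1 h
    exact ih h'

end RCOmega

namespace Structured

open RCOmega Op Cmd Global Temp Var

/-- The truth arrays of the formulas in a list, the first of them at `b`. -/
def Stack (M : Arena) (S : ℤ) (m : ℤ → ℤ) : ℤ → List Formula → Prop
  | b, [] => b = 2 * S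
  | b, A :: As => Level S m b (M.Holds A) ∧ Stack M S m (b - S) As

theorem Stack.two_mul_le {M : Arena} {S : ℤ} (hS : 0 ≤ S) {m : ℤ → ℤ} {As : List Formula} :
    ∀ {b : ℤ}, Stack M S m b As → 2 * S ≤ b := by
  induction As with
  | nil => exact fun h => h.ge
  | cons A As ih => exact fun h => by have := ih h.2; omega

theorem Stack.congr {M : Arena} {S : ℤ} (hS : 0 ≤ S) {m m' : ℤ → ℤ} {As : List Formula} :
    ∀ {b : ℤ}, Stack M S m b As → (∀ a, a < b + S → m' a = m a) → Stack M S m' b As := by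
  induction As with
  | nil => exact fun h _ => h
  | cons A As ih =>
    intro b h hm
    refine ⟨fun z h₁ h₂ => ?_, ih h.2 fun a ha => hm a (by omega)⟩
    rw [hm _ (by omega), h.1 z h₁ h₂]

theorem Heap.congr {M : Arena} {S W : ℤ} (hS : M.last < S) {m m' : ℤ → ℤ}
    (h : Heap M S W m) (hm : ∀ a, a < 2 * S → m' a = m a) : Heap M S W m' where
  lab y h₁ h₂ := by rw [hm _ (by omega), h.lab y h₁ h₂]
  par y h₁ h₂ := by rw [hm _ (by omega), h.par y h₁ h₂]
  bounded := h.bounded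

theorem Env.update_base {v : Global → ℤ} {S e W b : ℤ} (h : Env v S e W b) (b' : ℤ) :
    Env (Function.update v Global.base b') S e W b' := by
  obtain ⟨h1, h2, h3, h4, h5, h6, h7, h8⟩ := h
  exact ⟨by simpa, by simpa, by simpa, by simpa, by simpa, by simp, h7, h8⟩

/-- Update the stack of truth arrays according to the token in `code`. -/
def dispatch : Cmd :=
  op (addConst (t scratch) (g code) (-5)) ;;
  ite (t scratch) (downCmd ;; upCmd)
    (op (addConst (t scratch) (g code) (-4)) ;;
     ite (t scratch) (op (const (g flag) 0))
      (op (addConst (t scratch) (g code) (-3)) ;;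
       ite (t scratch) topCmd
        (op (addConst (t scratch) (g code) (-1)) ;;
         ite (t scratch) skip
          (ite (g code) conjCmd letterCmd))))

/-- The nested comparisons separate the codes above 5 (modalities, with `ω` already replaced by
`W`), 5, 4, 2 and 3, 1, and the negative codes of variables. The turnstile is excluded here by
`hstep`. -/
theorem dispatch_spec {M : Arena} {s : State} {S W b : ℤ} {tok : Token}
    {stk stk' : List Formula} (hE : Env s.g S M.last W b) (hM : Heap M S W s.mem)
    (hstk : Stack M S s.mem b stk) (hC : ∀ a, b + S ≤ a → s.mem a = 0)
    (ht : tok.Bounded W) (hcode : s.g code = tok.value W)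
    (hstep : evalStep tok stk = some stk') {Q : State → Prop}
    (hQ : ∀ (s' : State) (b' : ℤ), Env s'.g S M.last W b' → Stack M S s'.mem b' stk' →
      (∀ a, b' + S ≤ a → s'.mem a = 0) → (∀ a, a < 2 * S → s'.mem a = s.mem a) →
      s'.g ptr = s.g ptr → s'.g flag = s.g flag → s'.input = s.input → s'.output = s.output →
      s'.time ≤ s.time + 300 * S → Q s') : dispatch.wp Q s := by
  have h₁ := hE.finish_ge
  have h₂ := hE.finish_lt
  have hb := hstk.two_mul_le (by omega)
  rcases tok with _ | _ | _ | _ | _ | α | p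
  · have hv : s.g code = 1 := hcode
    rcases stk with _ | ⟨A, _ | ⟨B, stk⟩⟩ <;> simp only [evalStep, reduceCtorEq] at hstep
    obtain rfl := Option.some.inj hstep
    obtain ⟨hA, hB, hstk⟩ := hstk
    have hb' := hstk.two_mul_le (by omega)
    simp [dispatch, wp_op, wp_seq, wp_ite, Op.Ok, Op.apply, State.set, State.tick, State.get, hv]
    refine conjCmd_spec (S := S) (e := M.last) (W := W) (b := b - S) (T := M.Holds A)
      (U := M.Holds B) (by simpa using hE) (by omega) (by simpa using hA)
      (by simpa using hB) (fun z h => h.range) (fun z h => h.range) ?_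
    intro s' hg hi ho hL hL' hF ht
    simp only at hg hi ho ht hF
    refine hQ s' (b - S) ?_ ⟨hL, ?_⟩ ?_ ?_ ?_ ?_ hi ho (by omega)
    · rw [hg]; exact hE.update_base _
    · exact hstk.congr (by omega) fun a ha => hF a (by omega)
    · intro a ha
      by_cases h : a < b + S
      · have := hL' (a - b) (by omega) (by omega)
        rwa [show b - S + S + (a - b) = a by ring] at this
      · rw [hF a (by omega), hC a (by omega)]
    · exact fun a ha => hF a (by omega)
    · simp [hg]
    · simp [hg]
  · have hv : s.g code = 2 := hcode
    obtain rfl := Option.some.inj hstep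
    simp [dispatch, wp_op, wp_seq, wp_ite, Op.Ok, Op.apply, State.set, State.tick, State.get, hv,
      skip]
    refine hQ _ b hE hstk hC (fun _ _ => rfl) rfl rfl rfl rfl ?_
    simp only
    omega
  · have hv : s.g code = 3 := hcode
    obtain rfl := Option.some.inj hstep
    simp [dispatch, wp_op, wp_seq, wp_ite, Op.Ok, Op.apply, State.set, State.tick, State.get, hv,
      skip]
    refine hQ _ b hE hstk hC (fun _ _ => rfl) rfl rfl rfl rfl ?_
    simp only
    omega
  · have hv : s.g code = 4 := hcode
    obtain rfl := Option.some.inj hstep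
    simp [dispatch, wp_op, wp_seq, wp_ite, Op.Ok, Op.apply, State.set, State.tick, State.get, hv]
    refine topCmd_spec (S := S) (e := M.last) (W := W) (b := b) (by exact hE) (by omega)
      (by exact fun z h h' => hC _ (by omega)) ?_
    intro s' hg hi ho hL hF ht
    simp only at hg hi ho ht hF
    refine hQ s' (b + S) ?_ ⟨hL, ?_⟩ ?_ ?_ ?_ ?_ hi ho (by omega)
    · rw [hg]; exact hE.update_base _
    · rw [add_sub_cancel_right]
      exact hstk.congr (by omega) fun a ha => hF a (by omega)
    · exact fun a ha => by rw [hF a (by omega), hC a (by omega)]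
    · exact fun a ha => hF a (by omega)
    · simp [hg]
    · simp [hg]
  · simp only [evalStep, reduceCtorEq] at hstep
  · have hv := Token.seven_le_value ht
    rw [← hcode] at hv
    rcases stk with _ | ⟨A, stk⟩ <;> simp only [evalStep, reduceCtorEq] at hstep
    obtain rfl := Option.some.inj hstep
    obtain ⟨hA, hstk⟩ := hstk
    have hb' := hstk.two_mul_le (by omega)
    have hv' : 0 < s.g code + -5 := by omega
    have hv'' : ¬s.g code + -5 ≤ 0 := by omega
    simp only [dispatch, wp_op, wp_seq, wp_ite, Op.Ok, Op.apply, State.set, State.tick, State.get,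
      Function.update_self, hv', hv'', false_imp_iff, true_imp_iff, true_and, and_true]
    refine downCmd_spec (S := S) (W := W) (b := b) (by exact hE) (by omega)
      (by exact hM) ht (by exact hcode) (by exact hA)
      (by exact fun z h h' => hC _ (by omega)) ?_
    intro s₁ hg hi ho ha hL hF ht₁
    simp only at hg hi ho ht₁ hF
    refine upCmd_spec (S := S) (W := W) (b := b) (T := M.Holds A) (by rwa [hg]) (by omega)
      (hM.congr h₂ fun a ha => hF a (by omega)) ht (by rw [hg]; exact hcode) ?_
      (fun z h => h.range) hL ha ?_
    · intro z h h'
      rw [hF _ (by omega), hA z h h']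
    intro s' hg' hi' ho' hL' hC' hF' ht'
    rw [hg] at hg'
    refine hQ s' b (by rwa [hg']) ⟨hL', ?_⟩ ?_ ?_ (by rw [hg']) (by rw [hg'])
      (hi'.trans hi) (ho'.trans ho) (by omega)
    · exact hstk.congr (by omega) fun a ha => by rw [hF' a (by omega), hF a (by omega)]
    · intro a ha
      by_cases h : a < b + S + S
      · have := hC' (a - (b + S)) (by omega) (by omega)
        rwa [add_sub_cancel] at this
      · rw [hF' a (by omega), hF a (by omega), hC a (by omega)]
    · exact fun a ha => by rw [hF' a (by omega), hF a (by omega)]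
  · have hv : s.g code = -1 - p := hcode
    obtain rfl := Option.some.inj hstep
    have e₁ : ¬0 < s.g code + -5 := by omega
    have e₂ : ¬0 < s.g code + -4 := by omega
    have e₃ : ¬0 < s.g code + -3 := by omega
    have e₄ : ¬0 < s.g code + -1 := by omega
    have e₅ : ¬0 < s.g code := by omega
    have f₁ : s.g code + -5 ≤ 0 := by omega
    have f₂ : s.g code + -4 ≤ 0 := by omega
    have f₃ : s.g code + -3 ≤ 0 := by omega
    have f₄ : s.g code + -1 ≤ 0 := by omega
    have f₅ : s.g code ≤ 0 := by omega
    simp only [dispatch, wp_op, wp_seq, wp_ite, Op.Ok, Op.apply, State.set, State.tick, State.get,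
      Function.update_self, e₁, e₂, e₃, e₄, e₅, f₁, f₂, f₃, f₄, f₅, false_imp_iff, true_imp_iff,
      true_and]
    refine letterCmd_spec (S := S) (W := W) (b := b) (p := p) (by exact hE) (by omega)
      (by exact hM) (by exact hcode)
      (by exact fun z h h' => hC _ (by omega)) ?_
    intro s' hg hi ho hL hF ht
    simp only at hg hi ho ht hF
    refine hQ s' (b + S) ?_ ⟨hL, ?_⟩ ?_ ?_ ?_ ?_ hi ho (by omega)
    · rw [hg]; exact hE.update_base _
    · rw [add_sub_cancel_right]
      exact hstk.congr (by omega) fun a ha => hF a (by omega)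
    · exact fun a ha => by rw [hF a (by omega), hC a (by omega)]
    · exact fun a ha => hF a (by omega)
    · simp [hg]
    · simp [hg]

def evalBody : Cmd :=
  op (load (g code) (g ptr) (g zero)) ;;
  dispatch ;;
  op (addConst (g ptr) (g ptr) (-1))

/-- Evaluate the formula that ends at `stride - 1` and begins after a turnstile. -/
def evalCmd : Cmd :=
  op (addConst (g ptr) (g stride) (-1)) ;;
  op (add (g base) (g stride) (g stride)) ;;
  op (const (g flag) 1) ;;
  loop (g flag) evalBody

theorem Env.update_other {v : Global → ℤ} {S e W b : ℤ} (h : Env v S e W b) {x : Global}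
    (hx : x = Global.code ∨ x = ptr ∨ x = flag) (a : ℤ) : Env (Function.update v x a) S e W b := by
  obtain ⟨h1, h2, h3, h4, h5, h6, h7, h8⟩ := h
  rcases hx with rfl | rfl | rfl <;>
    exact ⟨by simpa, by simpa, by simpa, by simpa, by simpa, by simpa, h7, h8⟩

theorem evalCmd_spec {M : Arena} {s : State} {S W b : ℤ} {B : Formula}
    (hE : Env s.g S M.last W b) (hM : Heap M S W s.mem) (hS : S = M.last + 2 + B.length)
    (hB : ∀ i (h : i < B.tokens.length), s.mem (M.last + 2 + i) = B.tokens[i].value W)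
    (hturn : s.mem (M.last + 1) = 5) (hbound : ∀ tok ∈ B.tokens, tok.Bounded W)
    (hC : ∀ a, 3 * S ≤ a → s.mem a = 0) {Q : State → Prop}
    (hQ : ∀ s' : State, Env s'.g S M.last W (3 * S) → Level S s'.mem (3 * S) (M.Holds B) →
      s'.output = s.output → s'.time ≤ s.time + 500 * S * S → Q s') : evalCmd.wp Q s := by
  have h₁ := hE.finish_ge
  have h₂ := hE.finish_lt
  have h₃ := hE.stride
  simp only [evalCmd, wp_op, wp_seq, Op.Ok, Op.apply, State.set, State.tick, State.get,
    Function.update_apply, reduceCtorEq, if_false, true_and, h₃]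
  -- The budget for one symbol: 300 `S` for `dispatch`, the rest for the surrounding instructions
  -- and the test.
  obtain ⟨D, hD⟩ : ∃ D, D = 310 * S := ⟨_, rfl⟩
  have hlen : B.tokens.length = B.length := rfl
  have heval : evalTokens B.tokens = some [B] := by
    simpa using evalTokens_append B (ts := []) rfl
  -- `pre` is the unread part of `B` and `stk` the result of evaluating the rest. One round more
  -- than `pre.length` is needed, to meet the turnstile and clear the flag.
  refine wp_loop (fun n s' => ∃ b', Env s'.g S M.last W b' ∧ s'.output = s.output ∧
    (∀ a, a < 2 * S → s'.mem a = s.mem a) ∧ (∀ a, b' + S ≤ a → s'.mem a = 0) ∧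
    s'.time + n * D ≤ s.time + 10 + (B.length + 1) * D ∧
    (n = 0 ∧ s'.g flag = 0 ∧ Stack M S s'.mem b' [B] ∨
      s'.g flag = 1 ∧ ∃ pre suf stk, B.tokens = pre ++ suf ∧ evalTokens suf = some stk ∧
        Stack M S s'.mem b' stk ∧ s'.g ptr = M.last + 1 + pre.length ∧ n = pre.length + 1))
    (B.length + 1) ?_ ?_ ?_ ?_
  · refine ⟨2 * S, ?_, rfl, fun _ _ => rfl, fun a ha => hC a (by omega), ?_, .inr ⟨?_, B.tokens,
      [], [], by simp, rfl, rfl, ?_, by rw [hlen]⟩⟩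
    · rw [← two_mul]
      exact ((hE.update_other (.inr (.inl rfl)) _).update_base _).update_other
        (.inr (.inr rfl)) _
    · simp only [State.tick]; push_cast; omega
    · simp [State.tick]
    · simp [State.tick, hlen]; omega
  · rintro n s' ⟨b', -, -, -, -, -, ⟨rfl, h, -⟩ | ⟨h, pre, suf, stk, -, -, -, -, rfl⟩⟩ <;> simp [h]
  · rintro n s' ⟨b', hE', ho, hm, hC', ht, ⟨h, -⟩ | ⟨hf, pre, suf, stk, hpre, hsuf, hstk, hp, hn⟩⟩
    · omega
    obtain rfl : n = pre.length := by omega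
    rw [Nat.cast_add, Nat.cast_one, add_mul, one_mul] at ht
    have hz := hE'.zero
    rcases List.eq_nil_or_concat pre with rfl | ⟨pre', tok, rfl⟩
    · rw [List.nil_append] at hpre
      rw [← hpre, heval] at hsuf
      obtain rfl := Option.some.inj hsuf
      have hv : s'.mem (M.last + 1) = 5 := by rw [hm _ (by omega), hturn]
      simp only [List.length_nil, Nat.cast_zero, add_zero] at hp
      simp [evalBody, dispatch, wp_op, wp_seq, wp_ite, Op.Ok, Op.apply, State.set, State.tick,
        State.get, hp, hz, hv]
      refine ⟨by omega, b', ?_, ho, hm, hC', ?_, hstk⟩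
      · exact ((hE'.update_other (.inl rfl) _).update_other (.inr (.inr rfl)) _).update_other
          (.inr (.inl rfl)) _
      · simp at ht; omega
    · simp only [List.concat_eq_append, List.length_append, List.length_cons, List.length_nil,
        List.append_assoc, List.cons_append, List.nil_append, zero_add] at *
      have hlt : pre'.length < B.tokens.length := by simp [hpre]
      have htok : B.tokens[pre'.length] = tok := by simp [hpre]
      have hv : s'.mem (M.last + 1 + ((pre'.length + 1 : ℕ) : ℤ)) = tok.value W := by
        have := hB pre'.length hlt
        rw [htok] at this
        rw [hm _ (by push_cast; omega), ← this]
        congr 1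
        push_cast
        ring
      obtain ⟨stk', hstk'⟩ : ∃ stk', evalTokens (tok :: suf) = some stk' :=
        exists_evalTokens_of_append (l₁ := pre') (by rw [← hpre]; exact heval)
      have hstep : evalStep tok stk = some stk' := by
        simpa [evalTokens, hsuf] using hstk'
      simp only [evalBody, wp_op, wp_seq, Op.Ok, Op.apply, State.set, State.tick,
        State.get, hp, hz, hv, add_zero]
      refine ⟨by push_cast; omega, ?_⟩
      refine dispatch_spec (b := b') (tok := tok) (stk := stk) (stk' := stk') (W := W) (S := S)
        (by exact hE'.update_other (.inl rfl) _)
        (by exact hM.congr h₂ fun a ha => hm a ha) (by exact hstk) (by exact hC')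
        (hbound _ (by simp [hpre])) (by simp) hstep ?_
      intro s₁ b₁ hE₁ hstk₁ hC₁ hm₁ hp₁ hf₁ hi₁ ho₁ ht₁
      simp only [Function.update_apply, reduceCtorEq, if_false] at hp₁ hf₁ ho₁ ht₁ hm₁
      refine ⟨trivial, b₁, hE₁.update_other (.inr (.inl rfl)) _, ho₁.trans ho,
        fun a ha => (hm₁ a ha).trans (hm a ha), hC₁, ?_, .inr ⟨?_, pre', tok :: suf, stk', hpre,
        hstk', hstk₁, ?_, rfl⟩⟩
      · simp only [Op.apply, State.set, State.tick]
        push_cast at *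
        rw [add_mul (pre'.length : ℤ)] at *
        omega
      · simp [Op.apply, State.set, State.tick, hf₁, hf]
      · simp [Op.apply, State.set, State.tick, hp₁, hp]; ring
  · rintro s' ⟨b', hE', ho, hm, hC', ht, ⟨-, hf, hL, hb⟩ | ⟨hf, pre, suf, stk, -, -, -, -, h⟩⟩
    · obtain rfl : b' = 3 * S := by
        have : b' - S = 2 * S := hb
        omega
      refine hQ s' hE' hL ho ?_
      rw [hD] at ht
      push_cast at ht
      nlinarith
    · omega

end Structured

/-! ### The tree of the left formula. -/

namespace RCOmega

open Token

/-- One step of the construction of the tree of a formula that is read from left to right: the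
current node and the nodes at the open parentheses. -/
def parseStep : Token → ℤ → ℤ → List ℤ → Option (ℤ × List ℤ)
  | lparen, _, cur, stk => some (cur, cur :: stk)
  | wedge, _, _, c :: stk => some (c, c :: stk)
  | rparen, _, cur, _ :: stk => some (cur, stk)
  | modality _, pos, _, stk => some (pos, stk)
  | letter _, _, cur, stk => some (cur, stk)
  | verum, _, cur, stk => some (cur, stk)
  | _, _, _, _ => none

/-- The tokens stand in the tree from `pos` on, and can be read from left to right. -/
def Parsed (par : ℤ → ℤ) (lab : ℤ → Token) : List Token → ℤ → ℤ → List ℤ → Prop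
  | [], _, _, _ => True
  | tok :: ts, pos, cur, stk => lab pos = tok ∧ par pos = cur ∧
    ∃ cur' stk', parseStep tok pos cur stk = some (cur', stk') ∧
      Parsed par lab ts (pos + 1) cur' stk'

theorem Parsed.congr {par par' : ℤ → ℤ} {lab lab' : ℤ → Token} {ts : List Token} :
    ∀ {pos cur : ℤ} {stk : List ℤ}, Parsed par lab ts pos cur stk →
      (∀ y, pos ≤ y → par' y = par y) → (∀ y, pos ≤ y → lab' y = lab y) →
      Parsed par' lab' ts pos cur stk := by
  induction ts with
  | nil => exact fun _ _ _ => trivial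
  | cons tok ts ih =>
    rintro pos cur stk ⟨h₁, h₂, cur', stk', h₃, h₄⟩ hpar hlab
    exact ⟨(hlab _ le_rfl).trans h₁, (hpar _ le_rfl).trans h₂, cur', stk', h₃,
      ih h₄ (fun y hy => hpar y (by omega)) fun y hy => hlab y (by omega)⟩

theorem Parsed.lab_eq {par : ℤ → ℤ} {lab : ℤ → Token} {ts : List Token} :
    ∀ {pos cur : ℤ} {stk : List ℤ}, Parsed par lab ts pos cur stk →
      ∀ i (h : i < ts.length), lab (pos + i) = ts[i] := by
  induction ts with
  | nil => intro _ _ _ _ i h; simp at h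
  | cons tok ts ih =>
    rintro pos cur stk ⟨h₁, -, cur', stk', -, h₄⟩ i hi
    rcases i with _ | i
    · simpa using h₁
    · have := ih h₄ i (by simpa using hi)
      rw [List.getElem_cons_succ, ← this]
      congr 1
      push_cast
      ring

/-- The current node and all saved nodes are always positions that have been passed, which gives the
order condition in the definition of an arena. -/
theorem Parsed.range {par : ℤ → ℤ} {lab : ℤ → Token} {ts : List Token} :
    ∀ {pos cur : ℤ} {stk : List ℤ}, Parsed par lab ts pos cur stk →
      32 ≤ cur → cur < pos → (∀ c ∈ stk, 32 ≤ c ∧ c < pos) →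
      ∀ y, pos ≤ y → y < pos + ts.length → 32 ≤ par y ∧ par y < y := by
  induction ts with
  | nil => intro _ _ _ _ _ _ _ y h h'; simp at h'; omega
  | cons tok ts ih =>
    rintro pos cur stk ⟨-, h₂, cur', stk', h₃, h₄⟩ hc hc' hstk y hy hy'
    rcases hy.eq_or_lt with rfl | hy
    · omega
    have key : (32 ≤ cur' ∧ cur' < pos + 1) ∧ ∀ c ∈ stk', 32 ≤ c ∧ c < pos + 1 := by
      have hstk' : ∀ c ∈ stk, 32 ≤ c ∧ c < pos + 1 := fun c h => by
        have := hstk c h; omega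
      rcases tok with _ | _ | _ | _ | _ | γ | p <;> rcases stk with _ | ⟨c, stk⟩ <;>
        simp only [parseStep, reduceCtorEq, Option.some.injEq, Prod.mk.injEq] at h₃ <;>
        obtain ⟨rfl, rfl⟩ := h₃ <;>
        simp only [List.mem_cons, forall_eq_or_imp, List.not_mem_nil, false_imp_iff,
          implies_true, and_true] at hstk' ⊢ <;>
        first
          | omega
          | exact ⟨by omega, hstk'.1, hstk'.2⟩
          | exact ⟨by omega, by omega, hstk'⟩
          | exact ⟨hstk'.1, hstk'.1, hstk'.2⟩
          | exact ⟨by omega, hstk'.2⟩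
    simp only [List.length_cons] at hy'
    push_cast at hy'
    exact ih h₄ key.1.1 key.1.2 key.2 y (by omega) (by omega)

/-- The tokens can be read from left to right into a tree with no other nodes. -/
def Parsable (ts : List Token) (pos cur : ℤ) (stk : List ℤ) : Prop :=
  ∃ par lab, Parsed par lab ts pos cur stk ∧
    ∀ y, y < pos ∨ pos + ts.length ≤ y → lab y = turnstile

theorem Parsable.cons {ts : List Token} {pos cur cur' : ℤ} {stk stk' : List ℤ} {tok : Token}
    (h : Parsable ts (pos + 1) cur' stk')
    (hstep : parseStep tok pos cur stk = some (cur', stk')) :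
    Parsable (tok :: ts) pos cur stk := by
  obtain ⟨par, lab, h, h'⟩ := h
  refine ⟨Function.update par pos cur, Function.update lab pos tok, ⟨by simp, by simp, cur', stk',
    hstep, h.congr (fun y hy => ?_) fun y hy => ?_⟩, fun y hy => ?_⟩
  · exact Function.update_of_ne (by omega) _ _
  · exact Function.update_of_ne (by omega) _ _
  · simp only [List.length_cons] at hy
    push_cast at hy
    rw [Function.update_of_ne (by omega), h' y (by omega)]

/-- The hypothesis covers every `cur'` because the current node after a formula is unspecified: it
depends on the last modality read. This does no harm, since `∧` restores the node saved at the
parenthesis. -/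
theorem parsable_append (A : Formula) : ∀ {ts : List Token} {pos cur : ℤ} {stk : List ℤ},
    (∀ cur', Parsable ts (pos + A.length) cur' stk) → Parsable (A.tokens ++ ts) pos cur stk := by
  induction A with
  | var p => intro ts pos cur stk h; exact (h cur).cons rfl
  | top => intro ts pos cur stk h; exact (h cur).cons rfl
  | conj A B ihA ihB =>
    intro ts pos cur stk h
    simp only [Formula.tokens, List.append_assoc, List.cons_append, List.nil_append]
    refine Parsable.cons (cur' := cur) (stk' := cur :: stk) (ihA fun cur₁ => ?_) rfl
    refine Parsable.cons (cur' := cur) (stk' := cur :: stk) (ihB fun cur₂ => ?_) rfl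
    refine Parsable.cons (cur' := cur₂) (stk' := stk) ?_ rfl
    convert h cur₂ using 1
    rw [Formula.length_conj]; push_cast; ring
  | dia α A ih =>
    intro ts pos cur stk h
    refine Parsable.cons (cur' := pos) (stk' := stk) (ih fun cur₁ => ?_) rfl
    convert h cur₁ using 1
    rw [Formula.length_dia]; push_cast; ring

theorem Parsed.placed {par : ℤ → ℤ} {lab : ℤ → Token} (A : Formula) :
    ∀ {ts : List Token} {pos cur : ℤ} {stk : List ℤ}, Parsed par lab (A.tokens ++ ts) pos cur stk →
      Arena.Placed par lab A pos cur ∧ ∃ cur', Parsed par lab ts (pos + A.length) cur' stk := by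
  induction A with
  | var p =>
    rintro ts pos cur stk ⟨h₁, h₂, cur', stk', h₃, h₄⟩
    obtain ⟨rfl, rfl⟩ := Prod.mk.inj (Option.some.inj h₃)
    exact ⟨⟨h₁, h₂⟩, _, h₄⟩
  | top =>
    rintro ts pos cur stk ⟨h₁, h₂, cur', stk', h₃, h₄⟩
    obtain ⟨rfl, rfl⟩ := Prod.mk.inj (Option.some.inj h₃)
    exact ⟨h₁, _, h₄⟩
  | conj A B ihA ihB =>
    intro ts pos cur stk h
    simp only [Formula.tokens, List.append_assoc, List.cons_append, List.nil_append] at h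
    obtain ⟨h₁, h₂, cur', stk', h₃, h₄⟩ := h
    obtain ⟨rfl, rfl⟩ := Prod.mk.inj (Option.some.inj h₃)
    obtain ⟨hA, cur₁, k₁, k₂, cur₂, stk₂, k₃, k₄⟩ := ihA h₄
    obtain ⟨rfl, rfl⟩ := Prod.mk.inj (Option.some.inj k₃)
    obtain ⟨hB, cur₃, l₁, l₂, cur₄, stk₄, l₃, l₄⟩ := ihB k₄
    obtain ⟨rfl, rfl⟩ := Prod.mk.inj (Option.some.inj l₃)
    refine ⟨⟨h₁, hA, k₁, hB, l₁⟩, cur₃, ?_⟩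
    convert l₄ using 1
    rw [Formula.length_conj]; push_cast; ring
  | dia α A ih =>
    rintro ts pos cur stk ⟨h₁, h₂, cur', stk', h₃, h₄⟩
    obtain ⟨rfl, rfl⟩ := Prod.mk.inj (Option.some.inj h₃)
    obtain ⟨hA, cur₁, h₅⟩ := ih h₄
    refine ⟨⟨h₁, h₂, hA⟩, cur₁, ?_⟩
    convert h₅ using 1
    rw [Formula.length_dia]; push_cast; ring

/-- The tree of a formula. -/
theorem exists_arena (A : Formula) : ∃ M : Arena, M.last = 32 + A.length ∧
    Parsed M.par M.lab A.tokens 33 32 [] ∧ Arena.Placed M.par M.lab A 33 32 ∧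
    (∀ y, y < 33 ∨ M.last < y → M.lab y = turnstile) := by
  obtain ⟨par, lab, h, h'⟩ : Parsable (A.tokens ++ []) 33 32 [] :=
    parsable_append A fun cur => ⟨fun _ => 0, fun _ => turnstile, trivial, fun _ _ => rfl⟩
  have hp := h.placed.1
  rw [List.append_nil] at h h'
  have hlen : A.tokens.length = A.length := rfl
  rw [hlen] at h'
  have hr := h.range (by omega) (by omega) (by simp)
  rw [hlen] at hr
  have key : ∀ y, lab y ≠ turnstile → 32 ≤ par y ∧ par y < y ∧ y ≤ 32 + A.length := by
    intro y hy
    have h₁ : ¬(y < 33 ∨ 33 + (A.length : ℤ) ≤ y) := fun h => hy (h' y h)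
    have := hr y (by omega) (by omega)
    omega
  exact ⟨⟨par, lab, 32 + A.length, fun y γ h => key y (by simp [h]),
    fun y p h => key y (by simp [h])⟩, rfl, h, hp, fun y hy => h' y (by simp only at hy; omega)⟩

end RCOmega

/-! ### Reading the input and replacing the code of `ω`. -/

namespace Structured

open RCOmega Op Cmd Global Temp Var

def readBody : Cmd :=
  op (read (g code)) ;;
  ite (g code)
    (op (add (g omega) (g omega) (g code)) ;;
     op (addConst (g ptr) (g ptr) 1) ;;
     op (store (g ptr) (g zero) (g code)))
    (op (constSub (t scratch) 0 (g code)) ;;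
     ite (t scratch)
      (op (addConst (g ptr) (g ptr) 1) ;;
       op (store (g ptr) (g zero) (g code)))
      (op (const (g flag) 0)))

/-- Copy the input into the heap, from `33` on. -/
def readCmd : Cmd :=
  op (const (g one) 1) ;;
  op (const (g ptr) 32) ;;
  op (const (g omega) 7) ;;
  op (const (g code) 5) ;;
  op (store (g ptr) (g zero) (g code)) ;;
  op (const (g flag) 1) ;;
  loop (g flag) readBody ;;
  op (add (g stride) (g ptr) (g one))

/-- Codes are nonzero, so a 0 signals the end of the input. `W` is 7 plus the sum of the positive
codes and so exceeds each of them. The 5 at address 32 gives the root a label that is no modality,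
so the scans treat it like any other address. -/
theorem readCmd_spec {L : List ℤ} (hL : ∀ c ∈ L, c ≠ 0) {Q : State → Prop}
    (hQ : ∀ (s' : State) (S W : ℤ), s'.g one = 1 → s'.g zero = 0 → s'.g stride = S →
      s'.g omega = W → S = 33 + L.length → 7 ≤ W → (∀ c ∈ L, c < W) → s'.mem 32 = 5 →
      (∀ i (h : i < L.length), s'.mem (33 + i) = L[i]) → (∀ a, S ≤ a → s'.mem a = 0) →
      s'.output = [] → s'.time ≤ 50 * S → Q s') :
    readCmd.wp Q ⟨fun _ => 0, fun _ => 0, fun _ => 0, L, [], 0⟩ := by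
  simp only [readCmd, wp_op, wp_seq, Op.Ok, Op.apply, State.set, State.tick, State.get,
    Function.update_apply, reduceCtorEq, if_true, if_false, true_and]
  refine ⟨by norm_num, ?_⟩
  refine wp_loop (fun n s' => ∃ (done rest : List ℤ) (W : ℤ), L = done ++ rest ∧
    s'.input = rest ∧ s'.g one = 1 ∧ s'.g zero = 0 ∧ s'.g ptr = 32 + done.length ∧
    s'.g omega = W ∧ 7 ≤ W ∧ (∀ c ∈ done, c < W) ∧ s'.mem 32 = 5 ∧
    (∀ i (h : i < done.length), s'.mem (33 + i) = done[i]) ∧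
    (∀ a : ℤ, 33 + (done.length : ℤ) ≤ a → s'.mem a = 0) ∧ s'.output = [] ∧
    s'.time + 30 * n ≤ 50 + 30 * L.length ∧
    (n = 0 ∧ s'.g flag = 0 ∧ rest = [] ∨ n = rest.length + 1 ∧ s'.g flag = 1))
    (L.length + 1) ?_ ?_ ?_ ?_
  · refine ⟨[], L, 7, rfl, rfl, ?_⟩
    simp [State.tick, write_apply]
    exact ⟨fun a ha h => by omega, by omega⟩
  · rintro n s' ⟨done, rest, W, -, -, -, -, -, -, -, -, -, -, -, -, -, ⟨rfl, h, -⟩ | ⟨rfl, h⟩⟩ <;>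
      simp [h]
  · rintro n s' ⟨done, rest, W, hdr, hin, h1, h2, hp, hW, hW7, hlt, h32, hd, hz, ho, ht,
      ⟨h, -⟩ | ⟨hn, hf⟩⟩
    · omega
    obtain rfl : n = rest.length := by omega
    push_cast at ht
    rcases rest with _ | ⟨c, rest⟩
    · simp only [List.length_nil] at ht
      push_cast at ht ⊢
      simp only [readBody, wp_op, wp_seq, wp_ite, Op.Ok, Op.apply, State.set, State.tick, State.get,
        Function.update_apply, reduceCtorEq, if_true, if_false, true_and, hin, List.headD_nil,
        List.tail_nil]
      exact ⟨fun h => by omega, fun _ => ⟨fun h => by omega, fun _ => ⟨done, hdr, h1, h2, hp,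
        hW ▸ hW7, hW ▸ hlt, h32, hd, hz, ho, by rw [List.length_nil]; omega, .inl ⟨rfl, trivial⟩⟩⟩⟩
    · have hc : c ≠ 0 := hL c (by simp [hdr])
      have hmem : ∀ i (h : i < (done ++ [c]).length),
          write s'.mem (32 + done.length + 1) c (33 + i) = (done ++ [c])[i] := by
        intro i hi
        rw [write_apply]
        simp only [List.length_append, List.length_cons, List.length_nil] at hi
        rcases (show i < done.length ∨ i = done.length by omega) with h | rfl
        · rw [if_neg (by omega), hd i h, List.getElem_append_left h]
        · rw [if_pos (by omega)]; simp
      have hzero : ∀ a, 33 + ((done ++ [c]).length : ℤ) ≤ a →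
          write s'.mem (32 + done.length + 1) c a = 0 := by
        intro a ha
        simp only [List.length_append, List.length_cons, List.length_nil] at ha
        push_cast at ha
        rw [write_apply, if_neg (by omega), hz a (by omega)]
      have hroot : write s'.mem (32 + done.length + 1) c 32 = 5 := by
        rw [write_apply, if_neg (by omega), h32]
      have hdr' : L = (done ++ [c]) ++ rest := by simp [hdr]
      simp only [List.length_cons] at ht
      push_cast at ht ⊢
      simp only [readBody, wp_op, wp_seq, wp_ite, Op.Ok, Op.apply, State.set, State.tick,
        State.get, Function.update_apply, reduceCtorEq, if_true, if_false, true_and, hin,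
        List.headD_cons, List.tail_cons, hp, h2, hW, add_zero, h1, hf]
      refine ⟨fun h => ⟨by omega, done ++ [c], hdr', ?_, by omega,
        ?_, hroot, hmem, hzero, ho, ?_, .inr ⟨rfl, trivial⟩⟩, fun h => ⟨fun h' => ⟨by omega,
        done ++ [c], hdr', ?_, hW7,
        ?_, hroot, hmem, hzero, ho, ?_, .inr ⟨rfl, trivial⟩⟩, fun h' => by omega⟩⟩
      · simp; omega
      · intro d hd
        rcases List.mem_append.1 hd with hd | hd
        · have := hlt d hd; omega
        · obtain rfl : d = c := by simpa using hd
          omega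
      · push_cast [List.length_cons]; omega
      · simp; omega
      · intro d hd
        rcases List.mem_append.1 hd with hd | hd
        · exact hlt d hd
        · obtain rfl : d = c := by simpa using hd
          omega
      · push_cast [List.length_cons]; omega
  · rintro s' ⟨done, rest, W, hdr, hin, h1, h2, hp, hW, hW7, hlt, h32, hd, hz, ho, ht,
      ⟨-, hf, rfl⟩ | ⟨hn, hf⟩⟩
    · rw [List.append_nil] at hdr
      subst hdr
      refine ⟨trivial, hQ _ (33 + L.length) W h1 h2 ?_ hW rfl hW7 hlt h32 hd hz ho ?_⟩
      · simp [Op.apply, State.set, State.tick, hp, h1]; ring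
      · simp [Op.apply, State.set, State.tick]; push_cast at ht; omega
    · omega

def normBody : Cmd :=
  op (load (t sym) (t node) (g zero)) ;;
  op (addConst (t scratch) (t sym) (-5)) ;;
  ite (t scratch)
    (op (constSub (t scratch) 7 (t sym)) ;;
     ite (t scratch) (op (store (t node) (g zero) (g omega))) skip)
    skip ;;
  op (addConst (t node) (t node) (-1)) ;;
  op (addConst (t count) (t node) (-32))

/-- Replace the code of the modality `ω` by the number in `omega`. -/
def normCmd : Cmd :=
  op (addConst (t node) (g stride) (-1)) ;;
  op (addConst (t count) (t node) (-32)) ;;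
  loop (t count) normBody

theorem value_eq_ite (W : ℤ) (tok : Token) :
    tok.value W = if tok.code = 6 then W else tok.code := by
  rcases tok with _ | _ | _ | _ | _ | (_ | n) | p <;> simp [Token.value, Token.code] <;> omega

theorem normCmd_spec {s : State} {S W : ℤ} {L : List Token} (h2 : s.g zero = 0)
    (h3 : s.g stride = S) (hW : s.g omega = W) (hS : S = 33 + L.length)
    (hL : ∀ i (h : i < L.length), s.mem (33 + i) = L[i].code) {Q : State → Prop}
    (hQ : ∀ s' : State, s'.g = s.g → s'.output = s.output →
      (∀ i (h : i < L.length), s'.mem (33 + i) = L[i].value W) →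
      (∀ a, a < 33 ∨ S ≤ a → s'.mem a = s.mem a) → s'.time ≤ s.time + 50 * S → Q s') :
    normCmd.wp Q s := by
  simp only [normCmd, wp_op, wp_seq, Op.Ok, Op.apply, State.set, State.tick, State.get,
    Function.update_apply, if_true, true_and, h3]
  refine wp_loop (fun n s' => s'.g = s.g ∧ s'.output = s.output ∧ s'.t node = n + 32 ∧
    s'.t count = n ∧ n ≤ L.length ∧
    (∀ i (h : i < L.length), s'.mem (33 + i) = if i < n then L[i].code else L[i].value W) ∧
    (∀ a, a < 33 ∨ S ≤ a → s'.mem a = s.mem a) ∧ s'.time + 30 * n ≤ s.time + 10 + 30 * L.length)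
    L.length ?_ ?_ ?_ ?_
  · simp [State.tick, hS]
    refine ⟨by ring, by ring, fun i hi => by rw [if_pos hi, hL i hi], by omega⟩
  · rintro n s' ⟨-, -, -, h, -⟩
    simp [h]
  · rintro n s' ⟨hg, ho, hn, hc, hle, hm, hF, ht⟩
    push_cast at hn ht
    have hx : (n : ℤ) + 1 + 32 = 33 + n := by ring
    rw [hx] at hn
    have hv := hm n (by omega)
    rw [if_pos (by omega)] at hv
    have hval := value_eq_ite W L[n]
    have hcon : L[n].value W = L[n].code → ∀ i (h : i < L.length), s'.mem (33 + i) =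
        if i < n then L[i].code else L[i].value W := by
      intro h i hi
      rw [hm i hi]
      rcases lt_trichotomy i n with h' | rfl | h'
      · rw [if_pos (by omega), if_pos h']
      · rw [if_pos (by omega), if_neg (by omega), h]
      · rw [if_neg (by omega), if_neg (by omega)]
    simp only [normBody, skip, wp_op, wp_seq, wp_ite, Op.Ok, Op.apply, State.set, State.tick,
      State.get, Function.update_apply, reduceCtorEq, if_true, if_false, true_and, hg, hn, h2, hW,
      add_zero, hv, ho]
    refine ⟨by omega, fun h => ⟨fun h' => ⟨by omega, by omega, by omega, by omega, ?_, ?_, ?_⟩,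
      fun h' => ⟨by omega, by omega, by omega, hcon ?_, hF, by omega⟩⟩,
      fun h => ⟨by omega, by omega, by omega, hcon ?_, hF, by omega⟩⟩
    · rw [if_pos (by omega)] at hval
      intro i hi
      rw [write_apply, hm i hi]
      rcases lt_trichotomy i n with h' | rfl | h'
      · rw [if_neg (by omega), if_pos (by omega), if_pos h']
      · rw [if_pos rfl, if_neg (by omega), hval]
      · rw [if_neg (by omega), if_neg (by omega), if_neg (by omega)]
    · intro a ha
      rw [write_apply, if_neg (by omega), hF a ha]
    · omega
    · rw [if_neg (by omega)] at hval; exact hval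
    · rw [if_neg (by omega)] at hval; exact hval
  · rintro s' ⟨hg, ho, hn, hc, hle, hm, hF, ht⟩
    exact hQ s' hg ho (fun i hi => by simpa using hm i hi) hF (by push_cast at ht; omega)

end Structured

/-! ### Computing the parents. -/

namespace Structured

open RCOmega Op Cmd Global Temp Var

/-- The heap holds the list `l` from `b` on, the head of `l` at the highest address. -/
def HoldsList (m : ℤ → ℤ) (b : ℤ) : List ℤ → Prop
  | [] => True
  | c :: l => m (b + l.length) = c ∧ HoldsList m b l

theorem HoldsList.congr {m m' : ℤ → ℤ} {b : ℤ} {l : List ℤ} (h : HoldsList m b l)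
    (hm : ∀ a, b ≤ a → a < b + l.length → m' a = m a) : HoldsList m' b l := by
  induction l with
  | nil => trivial
  | cons c l ih =>
    simp only [List.length_cons] at hm
    push_cast at hm
    exact ⟨(hm _ (by omega) (by omega)).trans h.1,
      ih h.2 fun a h₁ h₂ => hm a h₁ (by omega)⟩

def parseSymbol : Cmd :=
  op (addConst (t scratch) (g Global.code) (-5)) ;;
  ite (t scratch) (op (add (g cur) (g ptr) (g zero))) (
    op (addConst (t scratch) (g Global.code) (-4)) ;;
    ite (t scratch) (op (const (g flag) 0)) (
      op (addConst (t scratch) (g Global.code) (-3)) ;;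
      ite (t scratch) skip (
        op (addConst (t scratch) (g Global.code) (-2)) ;;
        ite (t scratch)
          (op (addConst (t scratch) (g top) (-1)) ;; op (load (g cur) (t scratch) (g zero))) (
          op (addConst (t scratch) (g Global.code) (-1)) ;;
          ite (t scratch) (op (addConst (g top) (g top) (-1)))
            (ite (g Global.code)
              (op (store (g top) (g zero) (g cur)) ;; op (addConst (g top) (g top) 1))
              skip)))))

def parseBody : Cmd :=
  op (load (g Global.code) (g ptr) (g zero)) ;;
  op (store (g ptr) (g stride) (g cur)) ;;
  parseSymbol ;;
  op (addConst (g ptr) (g ptr) 1)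

/-- Compute the parents of the nodes from the symbols of the left formula. -/
def parseCmd : Cmd :=
  op (const (g ptr) 33) ;;
  op (const (g cur) 32) ;;
  op (add (g top) (g stride) (g stride)) ;;
  op (addConst (g top) (g top) 32) ;;
  op (const (g flag) 1) ;;
  loop (g flag) parseBody ;;
  op (addConst (g finish) (g ptr) (-2))

theorem parseSymbol_spec {s : State} {W b : ℤ} {tok : Token} {cur' : ℤ} {stk stk' : List ℤ}
    (htok : tok.Bounded W) (hstep : parseStep tok (s.g ptr) (s.g cur) stk = some (cur', stk'))
    (h2 : s.g zero = 0) (hcode : s.g Global.code = tok.value W)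
    (htop : s.g top = b + stk.length) (hstk : HoldsList s.mem b stk) (hb : 32 ≤ b)
    {Q : State → Prop}
    (hQ : ∀ s' : State, (∀ x, x ≠ cur → x ≠ top → s'.g x = s.g x) → s'.g cur = cur' →
      s'.g top = b + stk'.length → HoldsList s'.mem b stk' →
      (∀ a, a < b ∨ b + stk.length < a → s'.mem a = s.mem a) → stk'.length ≤ stk.length + 1 →
      s'.output = s.output → s'.time ≤ s.time + 40 → Q s') :
    parseSymbol.wp Q s := by
  rcases tok with _ | _ | _ | _ | _ | γ | p
  case lparen =>
    obtain ⟨rfl, rfl⟩ := Prod.mk.inj (Option.some.inj hstep)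
    replace hcode : s.g Global.code = 1 := hcode
    simp [parseSymbol, wp_op, wp_seq, wp_ite, Op.Ok, Op.apply, State.set, State.tick,
      State.get, hcode, h2, htop]
    refine ⟨by omega, hQ _ (fun x hx hx' => by simp [hx']) ?_ ?_ ?_ ?_ ?_ rfl ?_⟩
    · simp
    · simp; ring
    · refine ⟨by simp [write_apply], hstk.congr fun a h h' => ?_⟩
      simp only [write_apply]
      rw [if_neg (by omega)]
    · intro a ha
      simp only [write_apply]
      rw [if_neg (by omega)]
    · simp
    · simp only; omega
  case wedge =>
    rcases stk with _ | ⟨c, stk⟩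
    · simp [parseStep] at hstep
    obtain ⟨rfl, rfl⟩ := Prod.mk.inj (Option.some.inj hstep)
    replace hcode : s.g Global.code = 3 := hcode
    simp [parseSymbol, wp_op, wp_seq, wp_ite, Op.Ok, Op.apply, State.set, State.tick,
      State.get, hcode, h2, htop]
    refine ⟨by omega, hQ _ (fun x hx _ => by simp [hx]) ?_ ?_ hstk (fun _ _ => rfl) ?_ rfl ?_⟩
    · simpa [add_assoc] using hstk.1
    · simpa using htop
    · simp
    · simp only; omega
  case rparen =>
    rcases stk with _ | ⟨c, stk⟩
    · simp [parseStep] at hstep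
    obtain ⟨rfl, rfl⟩ := Prod.mk.inj (Option.some.inj hstep)
    replace hcode : s.g Global.code = 2 := hcode
    simp [parseSymbol, wp_op, wp_seq, wp_ite, Op.Ok, Op.apply, State.set, State.tick,
      State.get, hcode, h2, htop]
    refine hQ _ (fun x _ hx => by simp [hx]) ?_ ?_ hstk.2 (fun _ _ => rfl) ?_ rfl ?_
    · simp
    · simp; ring
    · simp; omega
    · simp only; omega
  case verum =>
    obtain ⟨rfl, rfl⟩ := Prod.mk.inj (Option.some.inj hstep)
    replace hcode : s.g Global.code = 4 := hcode
    simp [parseSymbol, skip, wp_op, wp_seq, wp_ite, Op.Ok, Op.apply, State.set, State.tick,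
      State.get, hcode]
    exact hQ _ (fun x _ _ => rfl) rfl htop hstk (fun _ _ => rfl) (by simp) rfl
      (by simp only; omega)
  case turnstile => simp [parseStep] at hstep
  case modality =>
    have h6 := Token.seven_le_value htok
    obtain ⟨rfl, rfl⟩ := Prod.mk.inj (Option.some.inj hstep)
    simp only [parseSymbol, wp_op, wp_seq, wp_ite, Op.Ok, Op.apply, State.set, State.tick,
      State.get, Function.update_apply, if_true, true_and, hcode, h2]
    exact ⟨fun _ => hQ _ (fun x hx _ => Function.update_of_ne hx _ _) (by simp)
      (by simpa using htop) hstk (fun _ _ => rfl) (by simp) rfl (by simp only; omega),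
      fun _ => by omega⟩
  case letter =>
    obtain ⟨rfl, rfl⟩ := Prod.mk.inj (Option.some.inj hstep)
    replace hcode : s.g Global.code = -1 - p := hcode
    simp only [parseSymbol, skip, wp_op, wp_seq, wp_ite, Op.Ok, Op.apply, State.set, State.tick,
      State.get, Function.update_apply, if_true, true_and, hcode]
    refine ⟨fun _ => by omega, fun _ => ⟨fun _ => by omega, fun _ => ⟨fun _ => by omega, fun _ =>
      ⟨fun _ => by omega, fun _ => ⟨fun _ => by omega, fun _ => ⟨fun _ => by omega, fun _ => ?_⟩⟩⟩⟩⟩⟩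
    exact hQ _ (fun x _ _ => rfl) rfl htop hstk (fun _ _ => rfl) (by simp) rfl
      (by simp only; omega)

/-- Symbols lie below `S`, parents between `S` and `2 * S`, and the stack of open parentheses from
`2 * S + 32` on. That stack is no longer than `A` and stays below `3 * S`, where the truth arrays
will begin. -/
theorem parseCmd_spec {M : Arena} {s : State} {S W : ℤ} {A : Formula} (h2 : s.g zero = 0)
    (h3 : s.g stride = S) (hlast : M.last = 32 + A.length)
    (hA : Parsed M.par M.lab A.tokens 33 32 []) (hS : M.last + 1 < S)
    (hm : ∀ i (h : i < A.tokens.length), s.mem (33 + i) = A.tokens[i].value W)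
    (hend : s.mem (M.last + 1) = 5) (hbound : ∀ tok ∈ A.tokens, tok.Bounded W)
    {Q : State → Prop}
    (hQ : ∀ s' : State, s'.g one = s.g one → s'.g zero = 0 → s'.g stride = S →
      s'.g omega = s.g omega → s'.g finish = M.last → s'.output = s.output →
      (∀ y, 33 ≤ y → y ≤ M.last → s'.mem (y + S) = M.par y) →
      (∀ a, a < S ∨ 3 * S ≤ a → s'.mem a = s.mem a) → s'.time ≤ s.time + 80 * S → Q s') :
    parseCmd.wp Q s := by
  have hlen : A.tokens.length = A.length := rfl
  simp only [parseCmd, wp_op, wp_seq, Op.Ok, Op.apply, State.set, State.tick, State.get,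
    Function.update_apply, reduceCtorEq, if_true, if_false, true_and, h3]
  refine wp_loop (fun n s' => (∀ x, x ≠ ptr → x ≠ cur → x ≠ top → x ≠ flag → x ≠ Global.code →
      s'.g x = s.g x) ∧ s'.output = s.output ∧
    (∀ a, a < S ∨ 3 * S ≤ a → s'.mem a = s.mem a) ∧ s'.time + 60 * n ≤ s.time + 75 + 60 * A.length ∧
    ((∃ (done rest : List Token) (stk : List ℤ), A.tokens = done ++ rest ∧ n = rest.length + 1 ∧
      Parsed M.par M.lab rest (s'.g ptr) (s'.g cur) stk ∧
      s'.g ptr = 33 + done.length ∧ s'.g top = 2 * S + 32 + stk.length ∧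
      HoldsList s'.mem (2 * S + 32) stk ∧ stk.length ≤ done.length ∧
      (∀ y, 33 ≤ y → y < s'.g ptr → s'.mem (y + S) = M.par y) ∧ s'.g flag = 1) ∨
    -- The turnstile stands at `M.last + 1`, and the pointer is advanced once more after it; hence
    -- the final `-2` in `parseCmd`.
    (n = 0 ∧ s'.g flag = 0 ∧ s'.g ptr = M.last + 2 ∧
      ∀ y, 33 ≤ y → y ≤ M.last → s'.mem (y + S) = M.par y))) (A.length + 1) ?_ ?_ ?_ ?_
  · refine ⟨fun x h₁ h₂ h₃ h₄ h₅ => by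
      simp [State.tick, h₁, h₂, h₃, h₄], rfl, fun _ _ => rfl, ?_,
      .inl ⟨[], A.tokens, [], rfl, by simp [hlen], by simpa [State.tick] using hA,
        by simp [State.tick], ?_, trivial, le_rfl, ?_, by simp [State.tick]⟩⟩
    · simp [State.tick]; omega
    · simp [State.tick]; omega
    · intro y h h'; simp [State.tick] at h'; omega
  · rintro n s' ⟨-, -, -, -, ⟨done, rest, stk, -, hn, -, -, -, -, -, -, h⟩ | ⟨hn, h, -⟩⟩ <;>
      simp [h, hn]
  · rintro n s' ⟨hg, ho, hF, ht, ⟨done, rest, stk, hdr, hn, hp, hptr, htop, hstk, hle, hpar, hf⟩ |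
      ⟨hn, -⟩⟩
    · have hlen' := congrArg List.length hdr
      rw [List.length_append, hlen] at hlen'
      have h2' : s'.g zero = 0 :=
        (hg _ (by decide) (by decide) (by decide) (by decide) (by decide)).trans h2
      have h3' : s'.g stride = S :=
        (hg _ (by decide) (by decide) (by decide) (by decide) (by decide)).trans h3
      push_cast at ht
      rcases rest with _ | ⟨tok, rest⟩
      · simp only [List.length_nil] at hn hlen'
        have hsym : s'.mem (33 + done.length) = 5 := by
          rw [hF _ (by omega), ← hend]; congr 1; omega
        simp [parseBody, parseSymbol, wp_op, wp_seq, wp_ite, Op.Ok, Op.apply, State.set,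
          State.tick, State.get, Function.update_apply, h2', h3', hptr, hsym, htop]
        refine ⟨by omega, by omega, fun x k₁ k₂ k₃ k₄ k₅ => ?_, ho, fun a ha => ?_, by omega,
          by omega, by omega, fun y h h' => ?_⟩
        · simpa [k₁, k₄, k₅] using hg x k₁ k₂ k₃ k₄ k₅
        · rw [write_apply, if_neg (by omega), hF a ha]
        · rw [write_apply, if_neg (by omega), hpar y h (by omega)]
      · simp only [List.length_cons] at hn hlen'
        have hsym : s'.mem (33 + done.length) = tok.value W := by
          rw [hF _ (by omega), hm _ (by omega)]; simp [hdr]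
        obtain ⟨h₁, h₂, cur', stk', h₃, h₄⟩ := hp
        simp only [parseBody, wp_op, wp_seq, Op.Ok, Op.apply, State.set, State.tick, State.get,
          Function.update_apply, reduceCtorEq, if_false, h2', h3', hptr,
          add_zero, hsym]
        refine ⟨by omega, by omega, parseSymbol_spec (tok := tok) (W := W) (b := 2 * S + 32)
          (cur' := cur') (stk := stk) (stk' := stk') (hbound _ (by simp [hdr])) ?_ ?_ ?_ ?_
          (hstk.congr fun a _ _ => ?_) (by omega) ?_⟩
        · simpa [hptr] using h₃
        · simpa using h2'
        · simp
        · simpa using htop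
        · exact (write_apply ..).trans (if_neg (by omega))
        · intro u hug huc hut hus huF hul huo hutime
          have hup : u.g ptr = 33 + done.length :=
            (hug _ (by decide) (by decide)).trans (by simpa using hptr)
          refine ⟨trivial, fun x k₁ k₂ k₃ k₄ k₅ => ?_, huo.trans ho, fun a ha => ?_, ?_,
            .inl ⟨done ++ [tok], rest, stk', by simp [hdr], by omega, ?_, ?_, ?_, hus, ?_, ?_, ?_⟩⟩
          · simp only [Op.apply, State.set, State.tick, Function.update_of_ne k₁]
            rw [hug x k₂ k₃, ← hg x k₁ k₂ k₃ k₄ k₅]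
            exact Function.update_of_ne k₅ _ _
          · rw [← hF a ha]
            exact (huF a (by omega)).trans ((write_apply ..).trans (if_neg (by omega)))
          · simp only [Op.apply, State.set, State.tick] at hutime ⊢
            omega
          · simp only [Op.apply, State.set, State.tick, Function.update_self]
            rw [Function.update_of_ne (by decide), huc, State.get_g, hup, ← hptr]
            exact h₄
          · simp [Op.apply, State.set, State.tick, hup]; ring
          · simpa [Op.apply, State.set, State.tick] using hut
          · simp; omega
          · intro y hy hy'
            simp only [Op.apply, State.set, State.tick, Function.update_self, State.get_g, hup]
              at hy' ⊢
            rw [huF _ (by omega)]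
            refine (write_apply ..).trans ?_
            split_ifs with h
            · rw [← h₂, hptr]; congr 1; omega
            · exact hpar y hy (by omega)
          · simp only [Op.apply, State.set, State.tick]
            rw [Function.update_of_ne (by decide), hug _ (by decide) (by decide)]
            simpa using hf
    · omega
  · rintro s' ⟨hg, ho, hF, ht, ⟨done, rest, stk, -, hn, -⟩ | ⟨-, -, hptr, hpar⟩⟩
    · omega
    · refine ⟨trivial, hQ _ (hg _ (by decide) (by decide) (by decide) (by decide) (by decide))
        ((hg _ (by decide) (by decide) (by decide) (by decide) (by decide)).trans h2)
        ((hg _ (by decide) (by decide) (by decide) (by decide) (by decide)).trans h3)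
        (hg _ (by decide) (by decide) (by decide) (by decide) (by decide)) ?_ ho hpar hF ?_⟩
      · simp [Op.apply, State.set, State.tick, hptr]
      · simp only [Op.apply, State.set, State.tick]
        omega

end Structured

/-! ### The whole program and its running time. -/

namespace Structured

open RCOmega Op Cmd Global Temp Var

/-- Decide a sequent. -/
def mainCmd : Cmd :=
  readCmd ;; normCmd ;; parseCmd ;; evalCmd ;;
  op (addConst (t scratch) (g Global.base) 32) ;;
  op (load (g Global.code) (t scratch) (g zero)) ;;
  op (print (g Global.code))

theorem Token.code_ne_zero (tok : Token) : tok.code ≠ 0 := by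
  rcases tok with _ | _ | _ | _ | _ | (_ | n) | p <;> simp only [Token.code] <;> omega

theorem Token.bounded_of_code_lt {W : ℤ} {tok : Token} (hW : 7 ≤ W) (h : tok.code < W) :
    tok.Bounded W :=
  ⟨hW, fun n hn => by subst hn; exact h⟩

theorem mainCmd_spec (A B : Formula) {Q : State → Prop}
    (hQ : ∀ s' : State, s'.output = [ind (Derivable A B)] →
      s'.time ≤ 800 * (34 + A.length + B.length) * (34 + A.length + B.length) → Q s') :
    mainCmd.wp Q ⟨fun _ => 0, fun _ => 0, fun _ => 0, encodeSequent A B, [], 0⟩ := by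
  obtain ⟨M, hlast, hpar, hplaced, hout⟩ := exists_arena A
  have hlenA : A.tokens.length = A.length := rfl
  have hlenB : B.tokens.length = B.length := rfl
  have hlen : (sequentTokens A B).length = A.length + 1 + B.length := by
    simp only [sequentTokens, List.length_append, List.length_singleton, hlenA, hlenB]
  have hlenE : (encodeSequent A B).length = A.length + 1 + B.length := by
    simp [encodeSequent, hlen]
  rw [mainCmd, wp_seq]
  refine readCmd_spec (by simp [encodeSequent, Token.code_ne_zero]) ?_
  intro s S W h1 h2 h3 h5 hS hW7 hWlt hroot hmem hzero ho ht
  rw [hlenE] at hS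
  push_cast at hS
  have hbound : ∀ tok ∈ sequentTokens A B, tok.Bounded W := fun tok h =>
    Token.bounded_of_code_lt hW7 (hWlt _ (List.mem_map_of_mem h))
  rw [wp_seq]
  refine normCmd_spec (L := sequentTokens A B) h2 h3 h5 (by rw [hlen]; push_cast; omega) ?_ ?_
  · intro i hi
    rw [hmem i (by rw [hlenE]; omega)]
    simp [encodeSequent]
  intro s₁ hg₁ ho₁ hm₁ hF₁ ht₁
  have htokA : ∀ i (h : i < A.tokens.length), s₁.mem (33 + i) = A.tokens[i].value W := by
    intro i hi
    rw [hm₁ i (by omega)]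
    simp [sequentTokens, hi]
  have hturn : s₁.mem (M.last + 1) = 5 := by
    have := hm₁ A.length (by omega)
    rw [show M.last + 1 = 33 + (A.length : ℤ) by omega, this]
    simp [sequentTokens, hlenA, Token.value, Token.code]
  have htokB : ∀ i (h : i < B.tokens.length),
      s₁.mem (M.last + 2 + i) = B.tokens[i].value W := by
    intro i hi
    have := hm₁ (A.length + 1 + i) (by omega)
    push_cast at this
    rw [show M.last + 2 + i = 33 + ((A.length : ℤ) + 1 + i) by omega, this]
    simp only [sequentTokens]
    rw [List.getElem_append_right (by simp [hlenA])]
    simp [hlenA]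
  rw [wp_seq]
  refine parseCmd_spec (M := M) (S := S) (W := W) (A := A) (by rw [hg₁, h2]) (by rw [hg₁, h3])
    hlast hpar (by omega) htokA hturn
    (fun tok h => hbound tok (by simp [sequentTokens, h])) ?_
  intro s₂ k1 k2 k3 k5 k4 ho₂ hpar₂ hF₂ ht₂
  have hE : Env s₂.g S M.last W (s₂.g Global.base) :=
    ⟨by rw [k1, hg₁, h1], k2, k3, k4, by rw [k5, hg₁, h5], rfl, by omega, by omega⟩
  have hheap : Heap M S W s₂.mem := by
    have hlab : ∀ i (h : i < A.tokens.length), M.lab (33 + i) = A.tokens[i] := hpar.lab_eq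
    refine ⟨fun y hy hy' => ?_, hpar₂, fun y => ?_⟩
    · rw [hF₂ _ (by omega)]
      rcases hy.eq_or_lt with rfl | hy
      · rw [hF₁ _ (by omega), hroot, hout _ (by omega)]
        rfl
      · obtain ⟨i, rfl⟩ : ∃ i : ℕ, y = 33 + i := ⟨(y - 33).toNat, by omega⟩
        rw [htokA i (by omega), hlab i (by omega)]
    · by_cases hy : y < 33 ∨ M.last < y
      · rw [hout y hy]
        exact ⟨hW7, fun n h => by simp at h⟩
      · obtain ⟨i, rfl⟩ : ∃ i : ℕ, y = 33 + i := ⟨(y - 33).toNat, by omega⟩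
        rw [hlab i (by omega)]
        exact hbound _ (by simp [sequentTokens])
  rw [wp_seq]
  refine evalCmd_spec (M := M) (S := S) (W := W) (B := B) hE hheap (by omega) ?_ ?_
    (fun tok h => hbound tok (by simp [sequentTokens, h])) ?_ ?_
  · intro i hi
    rw [hF₂ _ (by omega), htokB i hi]
  · rw [hF₂ _ (by omega), hturn]
  · intro a ha
    rw [hF₂ _ (by omega), hF₁ _ (by omega), hzero a (by omega)]
  intro s₃ hE₃ hlev ho₃ ht₃
  -- The answer is the entry of the root in the only array left, that of `B`.
  have hres := hlev 32 (by omega) (by omega)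
  rw [← ind_congr (Arena.derivable_iff_holds hplaced hlast B)] at hres
  simp only [wp_op, wp_seq, Op.Ok, Op.apply, State.set, State.tick, State.get,
    Function.update_apply, if_true, true_and, hE₃.base, hE₃.zero,
    add_zero, hres]
  refine ⟨by omega, hQ _ ?_ ?_⟩
  · simp [ho₃, ho₂, ho₁, ho]
  · have : (34 + A.length + B.length : ℤ) = S := by omega
    simp only [this]
    have : 34 * S ≤ S * S := by nlinarith
    nlinarith

end Structured

theorem mainTheorem10 :
    ∃ (P : RAM.Program) (q : Polynomial ℕ), q.natDegree = 4 ∧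
      ∀ A B : RCOmega.Formula,
        ∃ (t : ℕ) (answer : ℤ),
          t ≤ q.eval (A.length + B.length) ∧
          RAM.HaltsWith P (RCOmega.encodeSequent A B) [answer] t ∧
          ((answer = 1 ∧ RCOmega.Derivable A B) ∨ (answer = 0 ∧ ¬ RCOmega.Derivable A B)) := by
  -- The actual bound is quadratic, `800 * (34 + N) ^ 2`; degree four is reached by weakening it.
  refine ⟨Structured.mainCmd.compile 0, Polynomial.C 300000 * Polynomial.X ^ 4,
    Polynomial.natDegree_C_mul_X_pow 4 _ (by norm_num), fun A B => ?_⟩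
  obtain ⟨t, s, ht, ⟨ho, hs⟩, hrun⟩ := Structured.Cmd.runsTo_initial
    (Structured.mainCmd_spec A B
      (Q := fun s' => s'.output = [Structured.ind (RCOmega.Derivable A B)] ∧
        s'.time ≤ 800 * (34 + A.length + B.length) * (34 + A.length + B.length))
      fun s' h h' => ⟨h, h'⟩)
  refine ⟨t, Structured.ind (RCOmega.Derivable A B), ?_, ho ▸ hrun, ?_⟩
  · have hA : 1 ≤ A.length := by
      cases A <;> simp [RCOmega.Formula.length, RCOmega.Formula.tokens]
    have hB : 1 ≤ B.length := by
      cases B <;> simp [RCOmega.Formula.length, RCOmega.Formula.tokens]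
    have hN : t ≤ 800 * (34 + (A.length + B.length)) * (34 + (A.length + B.length)) := by
      zify
      calc (t : ℤ) ≤ _ := ht.trans hs
        _ = _ := by ring
    rw [Polynomial.eval_C_mul, Polynomial.eval_pow, Polynomial.eval_X]
    -- With `2 ≤ N` one has `34 + N ≤ 18 * N`, and `800 * 18 ^ 2 = 259200`.
    have hN' : 2 ≤ A.length + B.length := by omega
    generalize A.length + B.length = N at hN hN'
    calc t ≤ _ := hN
      _ ≤ 800 * (18 * N) * (18 * N) := by gcongr <;> omega
      _ = 259200 * (N ^ 2 * 1) := by ring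
      _ ≤ 300000 * (N ^ 2 * N ^ 2) := by
          gcongr
          · norm_num
          · exact Nat.one_le_pow _ _ (by omega)
      _ = _ := by ring
  · by_cases h : RCOmega.Derivable A B
    · exact .inl ⟨Structured.ind_of_true h, h⟩
    · exact .inr ⟨Structured.ind_of_false h, h⟩
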